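/- **Setting.** Let $0<\alpha<1$, $0<T<\infty$, $J=(0,T]$, $\lambda\in\mathbb R$, and let $\Omega\subset\mathbb R^d$ ($d\ge 1$) be a bounded open set. Write $(\cdot,\cdot)$ and $\|\cdot\|$ for the inner product and norm of $L^2(\Omega)$, $H_0^1(\Omega)$ for the closure of $C_c^\infty(\Omega)$ in $H^1(\Omega)$, and $\|\phi\|_1=(\|\phi\|^2+\|\nabla\phi\|^2)^{1/2}$. For every $t\in J$ let $\boldsymbol A(\cdot,t)\in L^\infty(\Omega;\mathbb R^{d\times d})$ be symmetric a.e. in $\Omega$, $\boldsymbol b(\cdot,t)\in L^\infty(\Omega;\mathbb R^d)$, $c(\cdot,t)\in L^\infty(\Omega)$ and $f(\cdot,t)\in L^2(\Omega)$; let $g\in L^\infty(\Omega\times\Omega)$. For $\phi,\psi\in H_0^1(\Omega)$ put $$a_0(t;\phi,\psi)=(\boldsymbol A(\cdot,t)\nabla\phi,\nabla\psi),\quad a_1(t;\phi,\psi)=(\boldsymbol b(\cdot,t)\cdot\nabla\phi+c(\cdot,t)\phi,\psi),\quad a=a_0+a_1,$$ $$\mathcal I\phi(\boldsymbol x)=\int_\Omega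 \phi(\boldsymbol y)\,g(\boldsymbol x,\boldsymbol y)\,d\boldsymbol y .$$ Let $\gamma_0,\beta_0>0$ and $L,\beta_1,\beta_2\ge 0$ be any constants for which, for all $\phi,\psi\in H^1_0(\Omega)$, $$|a_0(t;\phi,\psi)|\le\gamma_0\|\phi\|_1\|\psi\|_1\ \text{ and }\ a_0(t;\phi,\phi)\ge\beta_0\|\phi\|_1^2\quad\text{for a.e. }t\in J,$$ $$|a_0(t;\phi,\phi)-a_0(s;\phi,\phi)|\le L|t-s|\,\|\phi\|_1^2\quad\forall\, t,s\in J,\qquad |a_1(t;\phi,\psi)|\le\beta_1\|\phi\|_1\|\psi\|\quad\forall\, t\in J,$$ and $\|\mathcal I\phi\|\le\beta_2\|\phi\|$ for all $\phi\in L^2(\Omega)$. **Discretization.** Let $N\ge1$, $\gamma\ge 1$, $t_n=(n/N)^\gamma T$ for $0\le n\le N$, $\Delta t_j=t_j-t_{j-1}$, $\Delta t=\max_{1\le j\le N}\Delta t_j$, $\rho_n=\Delta t_n/\Delta t_{n-1}$ for $2\le n\le N$, $\rho=\max_{2\le n\le N}\rho_n$ ($\rho:=0$ if $N=1$). Let $$D_{t_n}^\alpha\phi=\sum_{j=1}^nK^{n,j}_{1-\alpha}(\phi^j-\phi^{j-1}),\qquad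 K^{n,j}_{1-\alpha}=\frac1{\Delta t_j}\int_{t_{j-1}}^{t_j}\frac{(t_n-s)^{-\alpha}}{\Gamma(1-\alpha)}\,ds .$$ Let $S_h$ be a finite-dimensional subspace of $H_0^1(\Omega)$, $f^n=f(\cdot,t_n)$, and let $u_h^0,\dots,u_h^N\in S_h$ satisfy $u_h^0=u_{0h}$ and $$(D_{t_n}^\alpha u_h,v_h)+a(t_n;u_h^n,v_h)=\lambda(\mathcal I(Eu_h^n),v_h)+(f^n,v_h)\qquad\forall\, v_h\in S_h,\ 1\le n\le N,$$ where $E$ is one of: $E\phi^n=\phi^n$ (fully implicit method); $E\phi^n=\phi^{n-1}$ (IMEX method of order one); $E\phi^1=\phi^0$ and $E\phi^n=(1+\rho_n)\phi^{n-1}-\rho_n\phi^{n-2}$ for $n\ge2$ (IMEX method of order two). **Theorem ($H^1$-norm stability).** Set $$\Lambda_1=\begin{cases}\dfrac{2(\beta_1^2+\lambda^2\beta_2^2)}{\beta_0}+\dfrac{L\,T^{1-\alpha}}{\beta_0\Gamma(2-\alpha)}&\text{fully implicit, or IMEX of order one,}\\[8pt]\dfrac{2\big(\beta_1^2+2\lambda^2\beta_2^2((1+\rho)^2+\rho^2)\big)}{\beta_0}+\dfrac{L\,T^{1-\alpha}}{\beta_0\Gamma(2-\alpha)}&\text{IMEX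 of order two,}\end{cases}$$ $$C_1=\max\Big\{\sqrt{\gamma_0/\beta_0},\ \sqrt{2T^\alpha/\beta_0}\Big\},\qquad E_\alpha(z)=\sum_{k=0}^\infty\frac{z^k}{\Gamma(1+k\alpha)} .$$ If $2\Lambda_1\Gamma(2-\alpha)\,(\Delta t)^\alpha<1$ (that is, $\Delta t<(2\Lambda_1\Gamma(2-\alpha))^{-1/\alpha}$, with no restriction when $\Lambda_1=0$), then $$\|u_h^n\|_1\le 2C_1E_\alpha(2\Lambda_1t_n^\alpha)\Big(\|u_h^0\|_1+\max_{1\le j\le n}\|f^j\|\Big),\qquad 1\le n\le N .$$ -/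

import Mathlib

open MeasureTheory Set
open scoped ContDiff Gradient

noncomputable section

/-! ### Function spaces on an open set `Ω ⊆ ℝ^d` -/

/-- `L²(Ω)`. -/
abbrev L2 {d : ℕ} (Ω : Set (EuclideanSpace ℝ (Fin d))) : Type :=
  Lp ℝ 2 (volume.restrict Ω)

/-- `L²(Ω; ℝ^d)`. -/
abbrev L2vec {d : ℕ} (Ω : Set (EuclideanSpace ℝ (Fin d))) : Type :=
  Lp (EuclideanSpace ℝ (Fin d)) 2 (volume.restrict Ω)

/-- `φ ∈ C_c^∞(Ω)`. -/
structure IsTestFunction {d : ℕ} (Ω : Set (EuclideanSpace ℝ (Fin d)))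
    (φ : EuclideanSpace ℝ (Fin d) → ℝ) : Prop where
  smooth : ContDiff ℝ ∞ φ
  compact : HasCompactSupport φ
  supp : tsupport φ ⊆ Ω

/-- The pairs `(φ, ∇φ)` with `φ ∈ C_c^∞(Ω)`, in `L²(Ω) × L²(Ω; ℝ^d)` with the norm
`(‖u‖² + ‖p‖²)^{1/2}`. -/
def testGraph {d : ℕ} (Ω : Set (EuclideanSpace ℝ (Fin d))) :
    Submodule ℝ (WithLp 2 (L2 Ω × L2vec Ω)) where
  carrier := {w | ∃ φ, IsTestFunction Ω φ ∧
    w.fst =ᵐ[volume.restrict Ω] φ ∧ w.snd =ᵐ[volume.restrict Ω] ∇ φ}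
  zero_mem' := by
    refine ⟨fun _ => 0, ⟨contDiff_const, HasCompactSupport.zero, ?_⟩, ?_, ?_⟩
    · rw [show (fun _ : EuclideanSpace ℝ (Fin d) => (0 : ℝ)) = 0 from rfl, tsupport_eq_empty_iff.2 rfl]
      exact empty_subset _
    · exact Lp.coeFn_zero _ _ _
    · filter_upwards [Lp.coeFn_zero (EuclideanSpace ℝ (Fin d)) 2 (volume.restrict Ω)] with x hx
      rw [gradient, fderiv_const_apply, map_zero]
      exact hx
  add_mem' := by
    rintro v w ⟨φ, hφ, h1, h2⟩ ⟨ψ, hψ, h3, h4⟩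
    refine ⟨φ + ψ, ⟨hφ.smooth.add hψ.smooth, hφ.compact.add hψ.compact,
      (tsupport_add φ ψ).trans (union_subset hφ.supp hψ.supp)⟩, ?_, ?_⟩
    · filter_upwards [h1, h3, Lp.coeFn_add v.fst w.fst] with x a b c
      rw [WithLp.add_fst, c, Pi.add_apply, Pi.add_apply, a, b]
    · filter_upwards [h2, h4, Lp.coeFn_add v.snd w.snd] with x a b c
      rw [WithLp.add_snd, c, Pi.add_apply, a, b, gradient, gradient, gradient,
        fderiv_add (hφ.smooth.differentiable (by simp) x)
          (hψ.smooth.differentiable (by simp) x), map_add]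
  smul_mem' := by
    rintro r w ⟨φ, hφ, h1, h2⟩
    refine ⟨r • φ, ⟨hφ.smooth.const_smul r, hφ.compact.smul_left,
      (tsupport_smul_subset_right (fun _ => r) φ).trans hφ.supp⟩, ?_, ?_⟩
    · filter_upwards [h1, Lp.coeFn_smul r w.fst] with x a b
      rw [WithLp.smul_fst, b, Pi.smul_apply, Pi.smul_apply, a]
    · filter_upwards [h2, Lp.coeFn_smul r w.snd] with x a b
      rw [WithLp.smul_snd, b, Pi.smul_apply, a, gradient, gradient,
        fderiv_const_smul (hφ.smooth.differentiable (by simp) x) r, map_smul]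

/-- `H₀¹(Ω)`, the closure of `C_c^∞(Ω)` in the `H¹`-norm. An element is the pair of a function
and its weak gradient, and the inherited norm is `‖φ‖₁ = (‖φ‖² + ‖∇φ‖²)^{1/2}`. -/
abbrev H01 {d : ℕ} (Ω : Set (EuclideanSpace ℝ (Fin d))) :
    Submodule ℝ (WithLp 2 (L2 Ω × L2vec Ω)) :=
  (testGraph Ω).topologicalClosure

/-- The function underlying an element of `H₀¹(Ω)`. -/
def h01Fun {d : ℕ} {Ω : Set (EuclideanSpace ℝ (Fin d))} (φ : H01 Ω) : L2 Ω := φ.1.fst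

/-- The weak gradient of an element of `H₀¹(Ω)`. -/
def h01Grad {d : ℕ} {Ω : Set (EuclideanSpace ℝ (Fin d))} (φ : H01 Ω) : L2vec Ω := φ.1.snd

/-! ### The bilinear forms and the integral operator -/

/-- `a₀(t; φ, ψ) = (A(·,t)∇φ, ∇ψ)`. -/
def formA0 {d : ℕ} {Ω : Set (EuclideanSpace ℝ (Fin d))}
    (A : ℝ → EuclideanSpace ℝ (Fin d) → Matrix (Fin d) (Fin d) ℝ)
    (t : ℝ) (φ ψ : H01 Ω) : ℝ :=
  ∫ x in Ω, ∑ i, ∑ j, A t x i j * h01Grad φ x j * h01Grad ψ x i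

/-- `a₁(t; φ, ψ) = (b(·,t)·∇φ + c(·,t)φ, ψ)`. -/
def formA1 {d : ℕ} {Ω : Set (EuclideanSpace ℝ (Fin d))}
    (b : ℝ → EuclideanSpace ℝ (Fin d) → EuclideanSpace ℝ (Fin d))
    (c : ℝ → EuclideanSpace ℝ (Fin d) → ℝ) (t : ℝ) (φ ψ : H01 Ω) : ℝ :=
  ∫ x in Ω, (inner ℝ (b t x) (h01Grad φ x) + c t x * h01Fun φ x) * h01Fun ψ x

/-- `(𝓘φ)(x) = ∫_Ω φ(y) g(x,y) dy`. -/
def integralOp {d : ℕ} {Ω : Set (EuclideanSpace ℝ (Fin d))}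
    (g : EuclideanSpace ℝ (Fin d) × EuclideanSpace ℝ (Fin d) → ℝ)
    (φ : L2 Ω) (x : EuclideanSpace ℝ (Fin d)) : ℝ :=
  ∫ y in Ω, φ y * g (x, y)

/-! ### The temporal mesh and the L1 formula -/

/-- The graded mesh `t_n = (n/N)^γ T`. -/
def meshPt (T γ : ℝ) (N n : ℕ) : ℝ := ((n : ℝ) / N) ^ γ * T

/-- `Δt_j = t_j - t_{j-1}`, for `j ≥ 1`. -/
def meshStep (T γ : ℝ) (N j : ℕ) : ℝ := meshPt T γ N j - meshPt T γ N (j - 1)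

/-- `ρ_n = Δt_n / Δt_{n-1}`, for `n ≥ 2`. -/
def stepRatio (T γ : ℝ) (N n : ℕ) : ℝ := meshStep T γ N n / meshStep T γ N (n - 1)

/-- `ρ = max_{2 ≤ n ≤ N} ρ_n`, and `0` if there is no such `n`. -/
def maxStepRatio (T γ : ℝ) (N : ℕ) : ℝ :=
  if h : 2 ≤ N then (Finset.Icc 2 N).sup' (Finset.nonempty_Icc.2 h) (stepRatio T γ N) else 0

/-- `k_β(t) = t^{β-1} / Γ(β)`. -/
def fracKernel (β t : ℝ) : ℝ := t ^ (β - 1) / Real.Gamma β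

/-- `K_β^{n,j} = (1/Δt_j) ∫_{t_{j-1}}^{t_j} k_β(t_n - s) ds`. -/
def discreteKernel (T γ : ℝ) (N : ℕ) (β : ℝ) (n j : ℕ) : ℝ :=
  (meshStep T γ N j)⁻¹ *
    ∫ s in (meshPt T γ N (j - 1))..(meshPt T γ N j), fracKernel β (meshPt T γ N n - s)

/-- The L1 formula `D^α_{t_n} φ = ∑_{j=1}^n K_{1-α}^{n,j} (φ^j - φ^{j-1})`. -/
def l1Derivative {V : Type*} [AddCommGroup V] [Module ℝ V] (T γ : ℝ) (N : ℕ) (α : ℝ)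
    (φ : ℕ → V) (n : ℕ) : V :=
  ∑ j ∈ Finset.Icc 1 n, discreteKernel T γ N (1 - α) n j • (φ j - φ (j - 1))

/-- The Mittag-Leffler function `E_α(z) = ∑_{k ≥ 0} z^k / Γ(1 + kα)`. -/
def mittagLeffler (α z : ℝ) : ℝ := ∑' k : ℕ, z ^ k / Real.Gamma (1 + k * α)

/-! ### The fully discrete schemes -/

/-- The three time discretizations of the integral term. -/
inductive TimeScheme
  | fullyImplicit
  | imexOne
  | imexTwo

/-- The extrapolation `Eφⁿ`, for `n ≥ 1`. -/
def extrapolate {V : Type*} [AddCommGroup V] [Module ℝ V] (T γ : ℝ) (N : ℕ)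
    (m : TimeScheme) (φ : ℕ → V) (n : ℕ) : V :=
  match m with
  | .fullyImplicit => φ n
  | .imexOne => φ (n - 1)
  | .imexTwo =>
    if n = 1 then φ 0
    else (1 + stepRatio T γ N n) • φ (n - 1) - stepRatio T γ N n • φ (n - 2)

/-- `u_h^0, …, u_h^N ∈ S_h` solves the scheme with initial value `u0h`: for `1 ≤ n ≤ N`, `v ∈ S_h`,
`(D^α_{t_n} u_h^n, v) + a(t_n; u_h^n, v) = lam (𝓘(E u_h^n), v) + (f^n, v)`, where `f^n = f(t_n)`. -/
structure IsDiscreteSolution {d : ℕ} {Ω : Set (EuclideanSpace ℝ (Fin d))}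
    (A : ℝ → EuclideanSpace ℝ (Fin d) → Matrix (Fin d) (Fin d) ℝ)
    (b : ℝ → EuclideanSpace ℝ (Fin d) → EuclideanSpace ℝ (Fin d))
    (c : ℝ → EuclideanSpace ℝ (Fin d) → ℝ)
    (g : EuclideanSpace ℝ (Fin d) × EuclideanSpace ℝ (Fin d) → ℝ)
    (f : ℝ → L2 Ω) (lam T γ : ℝ) (N : ℕ) (α : ℝ) (m : TimeScheme)
    (S : Submodule ℝ (H01 Ω)) (u0h : H01 Ω) (u : ℕ → H01 Ω) : Prop where
  mem : ∀ n ≤ N, u n ∈ S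
  init : u 0 = u0h
  eq : ∀ n, 1 ≤ n → n ≤ N → ∀ v ∈ S,
    inner ℝ (l1Derivative T γ N α (fun k => h01Fun (u k)) n) (h01Fun v)
        + (formA0 A (meshPt T γ N n) (u n) v + formA1 b c (meshPt T γ N n) (u n) v)
      = lam * (∫ x in Ω,
          integralOp g (extrapolate T γ N m (fun k => h01Fun (u k)) n) x * h01Fun v x)
        + inner ℝ (f (meshPt T γ N n)) (h01Fun v)

/-! ### The constants of the stability estimate -/

/-- The constant `Λ₁`. -/
def stabLambda (β₀ β₁ β₂ L lam T γ : ℝ) (N : ℕ) (α : ℝ) (m : TimeScheme) : ℝ :=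
  match m with
  | .fullyImplicit | .imexOne =>
    2 * ((β₁ ^ 2 + lam ^ 2 * β₂ ^ 2) / β₀) + L * T ^ (1 - α) / (β₀ * Real.Gamma (2 - α))
  | .imexTwo =>
    2 * ((β₁ ^ 2 + 2 * lam ^ 2 * β₂ ^ 2
        * ((1 + maxStepRatio T γ N) ^ 2 + maxStepRatio T γ N ^ 2)) / β₀)
      + L * T ^ (1 - α) / (β₀ * Real.Gamma (2 - α))

/-- The constant `C₁ = max{√(γ₀/β₀), √(2T^α/β₀)}`. -/
def stabC (γ₀ β₀ T α : ℝ) : ℝ := max √(γ₀ / β₀) √(2 * T ^ α / β₀)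

end

/-!
The proof is an energy argument in time followed by a fractional Grönwall inequality on the mesh.

*Energy inequality.* The scheme is tested with `v = D^α uⁿ ∈ S_h`. The L1 kernels increase in `j`,
being averages of `s ↦ k_{1-α}(t_n - s)` over consecutive cells. Hence
`2 a₀(t_n; uⁿ, D^α uⁿ)` is at least the L1 derivative of `a₀(t_n; u, u)`
(`energy_le_two_mul_apply_l1Derivative`). Replacing `a₀(t_n; uʲ, uʲ)` by `Wʲ = a₀(t_j; uʲ, uʲ)` costs
`L (t_n - t_j) ‖uʲ‖₁²`, and summation by parts bounds the total weight of these terms by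
`T^{1-α} / Γ(2-α)`. The lower-order terms are absorbed into `‖D^α uⁿ‖²`. This gives
`D^α Wⁿ ≤ Λ₁ max_{j ≤ n} Wʲ + ‖fⁿ‖²` (`l1Derivative_discreteEnergy_le`).

*Grönwall inequality.* The triangular array of L1 kernels has a nonnegative summation inverse `P`
(`exists_complementary_kernel`), a discrete fractional integral. On powers it is dominated by the
fractional integral itself: the convolution `k_{1-α} * k_p = k_{p+1-α}` is estimated on each cell by
Chebyshev's inequality if `p ≤ 1`, and by the value of `k_p` at the right endpoint together with
the growth of the mesh steps if `p ≥ 1`; the second estimate loses the last level. Summing the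
Mittag-Leffler series gives `∑_{j < n} P_j μ E_α(μ t_j^α) ≤ E_α(μ t_n^α) - 1`
(`sum_complementary_mittagLeffler_le`). The step-size condition says that the level `n` itself
contributes at most half of `Wⁿ`, whence the factors `2` in
`le_mittagLeffler_of_l1Derivative_le`.

*Conclusion.* Coercivity turns the bound for `Wⁿ` into one for `‖uⁿ‖₁²`, and `1 / Γ(1 + α) ≤ 4`
and `E_α ≥ 1` give the stated constants after taking square roots. The bounds on `a₀`, given for
almost every time, hold at the mesh points because `t ↦ a₀(t; φ, φ)` is Lipschitz continuous.
-/

/-! ### Fractional power kernels -/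

lemma fracKernel_pos {p t : ℝ} (hp : 0 < p) (ht : 0 < t) : 0 < fracKernel p t :=
  div_pos (Real.rpow_pos_of_pos ht _) (Real.Gamma_pos_of_pos hp)

lemma fracKernel_nonneg {p t : ℝ} (hp : 0 < p) (ht : 0 ≤ t) : 0 ≤ fracKernel p t :=
  div_nonneg (Real.rpow_nonneg ht _) (Real.Gamma_pos_of_pos hp).le

lemma fracKernel_one (t : ℝ) : fracKernel 1 t = 1 := by
  simp [fracKernel]

lemma fracKernel_add_one_zero {p : ℝ} (hp : 0 < p) : fracKernel (p + 1) 0 = 0 := by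
  simp [fracKernel, Real.zero_rpow hp.ne']

lemma continuous_fracKernel_add_one {p : ℝ} (hp : 0 < p) : Continuous (fracKernel (p + 1)) := by
  unfold fracKernel
  simp only [add_sub_cancel_right]
  exact (Real.continuous_rpow_const hp.le).div_const _

lemma hasDerivAt_fracKernel_add_one {p t : ℝ} (hp : 0 < p) (ht : 0 < t) :
    HasDerivAt (fracKernel (p + 1)) (fracKernel p t) t := by
  have h := (Real.hasDerivAt_rpow_const (p := p) (Or.inl ht.ne')).div_const (Real.Gamma (p + 1))
  have e : fracKernel (p + 1) = fun x : ℝ => x ^ p / Real.Gamma (p + 1) := by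
    funext x; simp [fracKernel]
  rw [e]
  refine h.congr_deriv ?_
  rw [fracKernel, Real.Gamma_add_one hp.ne', mul_div_mul_left _ _ hp.ne']

lemma intervalIntegrable_fracKernel {p : ℝ} (hp : 0 < p) (a b : ℝ) :
    IntervalIntegrable (fracKernel p) volume a b :=
  (intervalIntegral.intervalIntegrable_rpow' (by linarith)).div_const _

lemma integral_fracKernel {p : ℝ} (hp : 0 < p) (a b : ℝ) :
    ∫ s in a..b, fracKernel p s = fracKernel (p + 1) b - fracKernel (p + 1) a := by
  simp only [fracKernel, intervalIntegral.integral_div]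
  rw [integral_rpow (Or.inl (by linarith)), Real.Gamma_add_one hp.ne']
  simp only [sub_add_cancel, add_sub_cancel_right]
  rw [← sub_div, div_div]

lemma fracKernel_antitoneOn {p : ℝ} (hp : 0 < p) (hp1 : p ≤ 1) :
    AntitoneOn (fracKernel p) (Ioi 0) := fun x hx _ _ hxy =>
  div_le_div_of_nonneg_right (Real.rpow_le_rpow_of_nonpos hx hxy (by linarith))
    (Real.Gamma_pos_of_pos hp).le

lemma fracKernel_monotoneOn {p : ℝ} (hp1 : 1 ≤ p) :
    MonotoneOn (fracKernel p) (Ici 0) := fun x hx _ _ hxy =>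
  div_le_div_of_nonneg_right (Real.rpow_le_rpow hx hxy (by linarith))
    (Real.Gamma_pos_of_pos (by linarith)).le

/-- The semigroup law `k_q * k_p = k_{p+q}`, which is Euler's beta integral. -/
lemma integral_fracKernel_conv {p q t : ℝ} (hp : 0 < p) (hq : 0 < q) (ht : 0 < t) :
    ∫ s in (0 : ℝ)..t, fracKernel q (t - s) * fracKernel p s = fracKernel (p + q) t := by
  have h1 := Complex.betaIntegral_scaled p q ht
  rw [Complex.betaIntegral_eq_Gamma_mul_div _ _ (by simpa) (by simpa)] at h1
  have h2 : ∫ s in (0 : ℝ)..t, ((s : ℂ) ^ ((p : ℂ) - 1) * ((t : ℂ) - s) ^ ((q : ℂ) - 1))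
      = ∫ s in (0 : ℝ)..t, ((s ^ (p - 1) * (t - s) ^ (q - 1) : ℝ) : ℂ) := by
    refine intervalIntegral.integral_congr fun s hs => ?_
    rw [uIcc_of_le ht.le] at hs
    have e1 := Complex.ofReal_cpow hs.1 (p - 1)
    have e2 := Complex.ofReal_cpow (sub_nonneg.2 hs.2) (q - 1)
    push_cast at e1 e2 ⊢
    rw [e1, e2]
  rw [h2, intervalIntegral.integral_ofReal] at h1
  have e3 := Complex.ofReal_cpow ht.le (p + q - 1)
  push_cast at e3
  rw [← e3, ← Complex.ofReal_add, Complex.Gamma_ofReal, Complex.Gamma_ofReal,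
    Complex.Gamma_ofReal] at h1
  norm_cast at h1
  have gp := (Real.Gamma_pos_of_pos hp).ne'
  have gq := (Real.Gamma_pos_of_pos hq).ne'
  have h4 : ∀ s : ℝ, fracKernel q (t - s) * fracKernel p s
      = (Real.Gamma p * Real.Gamma q)⁻¹ * (s ^ (p - 1) * (t - s) ^ (q - 1)) := by
    intro s
    unfold fracKernel
    field_simp
  simp only [h4]
  rw [intervalIntegral.integral_const_mul, h1, fracKernel]
  field_simp

lemma intervalIntegrable_fracKernel_conv {p q t : ℝ} (hp : 0 < p) (hq : 0 < q) (ht : 0 < t) :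
    IntervalIntegrable (fun s => fracKernel q (t - s) * fracKernel p s) volume 0 t := by
  apply intervalIntegral.intervalIntegrable_of_integral_ne_zero
  rw [integral_fracKernel_conv hp hq ht]
  exact (fracKernel_pos (add_pos hp hq) ht).ne'

lemma intervalIntegrable_fracKernel_sub {q : ℝ} (hq : 0 < q) (t a b : ℝ) :
    IntervalIntegrable (fun s => fracKernel q (t - s)) volume a b := by
  have h := (intervalIntegrable_fracKernel hq (t - a) (t - b)).comp_sub_left t
  simpa using h

lemma integral_fracKernel_sub {q : ℝ} (hq : 0 < q) (t a b : ℝ) :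
    ∫ s in a..b, fracKernel q (t - s) = fracKernel (q + 1) (t - a) - fracKernel (q + 1) (t - b) := by
  rw [intervalIntegral.integral_comp_sub_left (fun s => fracKernel q s) t, integral_fracKernel hq]

/-- The average of `s ↦ k_q(t - s)` over a cell is attained in its interior. -/
lemma exists_fracKernel_sub_eq_average {q t a b : ℝ} (hq : 0 < q) (hab : a < b) (hbt : b ≤ t) :
    ∃ ξ ∈ Ioo a b, (b - a)⁻¹ * ∫ s in a..b, fracKernel q (t - s) = fracKernel q (t - ξ) := by
  have hc : Continuous fun s => -fracKernel (q + 1) (t - s) :=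
    ((continuous_fracKernel_add_one hq).comp (continuous_const.sub continuous_id)).neg
  obtain ⟨ξ, hξ, h⟩ := exists_hasDerivAt_eq_slope (fun s => -fracKernel (q + 1) (t - s))
    (fun s => fracKernel q (t - s)) hab hc.continuousOn (fun x hx => by
      have h1 := hasDerivAt_fracKernel_add_one hq (show 0 < t - x by linarith [hx.2])
      have h2 := (h1.comp x ((hasDerivAt_id x).const_sub t)).neg
      exact h2.congr_deriv (by ring))
  refine ⟨ξ, hξ, ?_⟩
  rw [h, integral_fracKernel_sub hq]
  field_simp
  ring

/-- Chebyshev's integral inequality on a cell: the kernel `s ↦ k_q(t - s)` increases and `k_p`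
decreases. -/
lemma integral_fracKernel_conv_cell_le_of_le_one {p q t a b : ℝ} (hp : 0 < p) (hp1 : p ≤ 1)
    (hq : 0 < q) (hq1 : q ≤ 1) (ha : 0 ≤ a) (hab : a < b) (hbt : b ≤ t) :
    ∫ s in a..b, fracKernel q (t - s) * fracKernel p s
      ≤ ((b - a)⁻¹ * ∫ s in a..b, fracKernel q (t - s))
        * (fracKernel (p + 1) b - fracKernel (p + 1) a) := by
  obtain ⟨ξ, hξ, h⟩ := exists_fracKernel_sub_eq_average hq hab hbt
  set κ := fracKernel q (t - ξ) with hκ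
  set μ := fracKernel p ξ with hμ
  have hI : IntervalIntegrable (fun s => fracKernel q (t - s) * fracKernel p s) volume a b :=
    (intervalIntegrable_fracKernel_conv hp hq (by linarith)).mono_set
      (by rw [uIcc_of_le hab.le, uIcc_of_le (by linarith)]; exact Icc_subset_Icc ha hbt)
  have hk := intervalIntegrable_fracKernel_sub hq t a b
  have hv := intervalIntegrable_fracKernel hp a b
  have key : ∫ s in a..b, fracKernel q (t - s) * fracKernel p s
      ≤ ∫ s in a..b, (κ * fracKernel p s + μ * fracKernel q (t - s) - κ * μ) := by
    refine intervalIntegral.integral_mono_on_of_le_Ioo hab.le hI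
      (((hv.const_mul κ).add (hk.const_mul μ)).sub (by simp)) fun s hs => ?_
    -- `(k_q(t - s) - κ) (k_p(s) - μ) ≤ 0`, as the two factors change sign at the same point `ξ`
    have hs0 : (0 : ℝ) < s := by linarith [hs.1]
    have hξ0 : (0 : ℝ) < ξ := by linarith [hξ.1]
    have hst : 0 < t - s := by linarith [hs.2]
    have hξt : 0 < t - ξ := by linarith [hξ.2]
    rcases le_total s ξ with hle | hle
    · have h1 : fracKernel q (t - s) ≤ κ :=
        fracKernel_antitoneOn hq hq1 (mem_Ioi.2 hξt) (mem_Ioi.2 hst) (by linarith)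
      have h2 : μ ≤ fracKernel p s :=
        fracKernel_antitoneOn hp hp1 (mem_Ioi.2 hs0) (mem_Ioi.2 hξ0) hle
      nlinarith
    · have h1 : κ ≤ fracKernel q (t - s) :=
        fracKernel_antitoneOn hq hq1 (mem_Ioi.2 hst) (mem_Ioi.2 hξt) (by linarith)
      have h2 : fracKernel p s ≤ μ :=
        fracKernel_antitoneOn hp hp1 (mem_Ioi.2 hξ0) (mem_Ioi.2 hs0) hle
      nlinarith
  have hsum : ∫ s in a..b, fracKernel q (t - s) = κ * (b - a) := by
    rw [← h]; field_simp [(sub_pos.2 hab).ne']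
  rw [intervalIntegral.integral_sub ((hv.const_mul κ).add (hk.const_mul μ)) (by simp),
    intervalIntegral.integral_add (hv.const_mul κ) (hk.const_mul μ),
    intervalIntegral.integral_const_mul, intervalIntegral.integral_const_mul,
    integral_fracKernel hp, hsum, intervalIntegral.integral_const, smul_eq_mul] at key
  rw [h]
  linarith

lemma integral_fracKernel_conv_cell_le_of_one_le {p q t a b : ℝ} (hp1 : 1 ≤ p)
    (hq : 0 < q) (ha : 0 ≤ a) (hab : a < b) (hbt : b ≤ t) :
    ∫ s in a..b, fracKernel q (t - s) * fracKernel p s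
      ≤ ((b - a)⁻¹ * ∫ s in a..b, fracKernel q (t - s)) * ((b - a) * fracKernel p b) := by
  have hI : IntervalIntegrable (fun s => fracKernel q (t - s) * fracKernel p s) volume a b :=
    (intervalIntegrable_fracKernel_conv (by linarith) hq (by linarith)).mono_set
      (by rw [uIcc_of_le hab.le, uIcc_of_le (by linarith)]; exact Icc_subset_Icc ha hbt)
  have key : ∫ s in a..b, fracKernel q (t - s) * fracKernel p s
      ≤ ∫ s in a..b, fracKernel q (t - s) * fracKernel p b := by
    refine intervalIntegral.integral_mono_on_of_le_Ioo hab.le hI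
      ((intervalIntegrable_fracKernel_sub hq t a b).mul_const _) fun s hs => ?_
    exact mul_le_mul_of_nonneg_left
      (fracKernel_monotoneOn hp1 (by simp; linarith [hs.1]) (by simp; linarith) hs.2.le)
      (fracKernel_nonneg hq (by linarith [hs.2]))
  rw [intervalIntegral.integral_mul_const] at key
  refine key.trans (le_of_eq ?_)
  field_simp [(sub_pos.2 hab).ne']

/-! ### The Mittag-Leffler function -/

lemma rpow_mul_exp_neg_le_Gamma {c x : ℝ} (hc : 0 ≤ c) (hx : 0 ≤ x) :
    c ^ x * Real.exp (-c) ≤ Real.Gamma (1 + x) := by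
  rw [Real.Gamma_eq_integral (by linarith)]
  have hint := Real.GammaIntegral_convergent (show 0 < 1 + x by linarith)
  calc c ^ x * Real.exp (-c) = ∫ t in Ioi c, c ^ x * Real.exp (-t) := by
        rw [integral_const_mul, integral_exp_neg_Ioi]
    _ ≤ ∫ t in Ioi c, Real.exp (-t) * t ^ (1 + x - 1) := by
        refine setIntegral_mono_on ((integrableOn_exp_neg_Ioi c).const_mul _)
          (hint.mono_set (Ioi_subset_Ioi hc)) measurableSet_Ioi fun t ht => ?_
        rw [mul_comm, add_sub_cancel_left]
        exact mul_le_mul_of_nonneg_left (Real.rpow_le_rpow hc (le_of_lt ht) hx) (Real.exp_pos _).le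
    _ ≤ ∫ t in Ioi (0 : ℝ), Real.exp (-t) * t ^ (1 + x - 1) := by
        refine setIntegral_mono_set hint ?_ (Ioi_subset_Ioi hc).eventuallyLE
        filter_upwards [ae_restrict_mem measurableSet_Ioi] with t ht
        exact mul_nonneg (Real.exp_pos _).le (Real.rpow_nonneg (le_of_lt ht) _)

lemma summable_mittagLeffler {α z : ℝ} (hα : 0 < α) (hz : 0 ≤ z) :
    Summable fun k : ℕ => z ^ k / Real.Gamma (1 + k * α) := by
  -- `Γ(1 + kα) ≥ (c^α)^k e^{-c}` with `c^α = 2 (z + 1)` gives a geometric majorant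
  set c : ℝ := (2 * (z + 1)) ^ α⁻¹ with hc
  have hc0 : 0 < c := Real.rpow_pos_of_pos (by linarith) _
  have hca : c ^ α = 2 * (z + 1) := by
    rw [hc, Real.rpow_inv_rpow (by linarith) hα.ne']
  have hr : z / (2 * (z + 1)) < 1 := by rw [div_lt_one (by linarith)]; linarith
  refine Summable.of_nonneg_of_le (fun k => ?_) (fun k => ?_)
    ((summable_geometric_of_lt_one (by positivity) hr).mul_left (Real.exp c))
  · exact div_nonneg (pow_nonneg hz _) (Real.Gamma_pos_of_pos (by positivity)).le
  · have h := rpow_mul_exp_neg_le_Gamma hc0.le (show 0 ≤ (k : ℝ) * α by positivity)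
    rw [mul_comm (k : ℝ) α, Real.rpow_mul hc0.le, hca, Real.rpow_natCast, mul_comm α] at h
    calc z ^ k / Real.Gamma (1 + k * α) ≤ z ^ k / ((2 * (z + 1)) ^ k * Real.exp (-c)) :=
          div_le_div_of_nonneg_left (pow_nonneg hz _) (by positivity) h
      _ = Real.exp c * (z / (2 * (z + 1))) ^ k := by
          rw [Real.exp_neg, div_pow]; field_simp

lemma mittagLeffler_mono {α y z : ℝ} (hα : 0 < α) (hy : 0 ≤ y) (hyz : y ≤ z) :
    mittagLeffler α y ≤ mittagLeffler α z := by
  refine (summable_mittagLeffler hα hy).tsum_le_tsum (fun k => ?_)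
    (summable_mittagLeffler hα (hy.trans hyz))
  exact div_le_div_of_nonneg_right (pow_le_pow_left₀ hy hyz _)
    (Real.Gamma_pos_of_pos (by positivity)).le

lemma mittagLeffler_zero (α : ℝ) : mittagLeffler α 0 = 1 := by
  unfold mittagLeffler
  rw [tsum_eq_single 0 (fun k hk => by simp [hk])]
  simp

lemma one_le_mittagLeffler {α z : ℝ} (hα : 0 < α) (hz : 0 ≤ z) : 1 ≤ mittagLeffler α z :=
  (mittagLeffler_zero α).symm.le.trans (mittagLeffler_mono hα le_rfl hz)

/-! ### The graded mesh -/

section Mesh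

variable {T γ α : ℝ} {N : ℕ}

lemma meshPt_zero (hγ : 1 ≤ γ) : meshPt T γ N 0 = 0 := by
  simp [meshPt, Real.zero_rpow (show γ ≠ 0 by linarith)]

lemma meshPt_strictMono (hT : 0 < T) (hγ : 1 ≤ γ) (hN : 1 ≤ N) : StrictMono (meshPt T γ N) := by
  intro i j hij
  have hN' : (0 : ℝ) < N := by exact_mod_cast hN
  have hij' : (i : ℝ) < j := by exact_mod_cast hij
  exact mul_lt_mul_of_pos_right (Real.rpow_lt_rpow (by positivity)
    (div_lt_div_of_pos_right hij' hN') (by linarith)) hT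

lemma meshPt_nonneg (hT : 0 < T) (n : ℕ) : 0 ≤ meshPt T γ N n :=
  mul_nonneg (Real.rpow_nonneg (by positivity) _) hT.le

lemma meshPt_pos (hT : 0 < T) (hγ : 1 ≤ γ) (hN : 1 ≤ N) {n : ℕ} (hn : 1 ≤ n) :
    0 < meshPt T γ N n :=
  (meshPt_nonneg hT 0).trans_lt (meshPt_strictMono hT hγ hN (show 0 < n by omega))

lemma meshPt_le (hT : 0 < T) (hγ : 1 ≤ γ) (hN : 1 ≤ N) {n : ℕ} (hn : n ≤ N) :
    meshPt T γ N n ≤ T := by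
  have hN' : (N : ℝ) ≠ 0 := by exact_mod_cast (show N ≠ 0 by omega)
  refine ((meshPt_strictMono hT hγ hN).monotone hn).trans_eq ?_
  simp [meshPt, div_self hN']

lemma meshStep_pos (hT : 0 < T) (hγ : 1 ≤ γ) (hN : 1 ≤ N) {j : ℕ} (hj : 1 ≤ j) :
    0 < meshStep T γ N j :=
  sub_pos.2 (meshPt_strictMono hT hγ hN (by omega))

/-- The mesh is graded towards `t = 0`: convexity of `x ↦ x^γ` makes the steps grow. -/
lemma meshStep_le_succ (hT : 0 < T) (hγ : 1 ≤ γ) (hN : 1 ≤ N) {j : ℕ} (hj : 1 ≤ j) :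
    meshStep T γ N j ≤ meshStep T γ N (j + 1) := by
  obtain ⟨i, rfl⟩ : ∃ i, j = i + 1 := ⟨j - 1, by omega⟩
  have hN' : (0 : ℝ) < N := by exact_mod_cast hN
  have hx : (i : ℝ) / N ∈ Ici (0 : ℝ) := mem_Ici.2 (by positivity)
  have hy : ((i + 2 : ℕ) : ℝ) / N ∈ Ici (0 : ℝ) := mem_Ici.2 (by positivity)
  have h := (convexOn_rpow hγ).2 hx hy (show (0 : ℝ) ≤ 1 / 2 by norm_num)
    (show (0 : ℝ) ≤ 1 / 2 by norm_num) (by norm_num)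
  have e : (1 / 2 : ℝ) • ((i : ℝ) / N) + (1 / 2 : ℝ) • (((i + 2 : ℕ) : ℝ) / N)
      = ((i + 1 : ℕ) : ℝ) / N := by
    simp only [smul_eq_mul]; push_cast; field_simp; ring
  rw [e] at h
  simp only [smul_eq_mul] at h
  simp only [meshStep, meshPt, Nat.add_sub_cancel]
  nlinarith

lemma stepRatio_nonneg (hT : 0 < T) (hγ : 1 ≤ γ) (hN : 1 ≤ N) {n : ℕ} (hn : 2 ≤ n) :
    0 ≤ stepRatio T γ N n :=
  div_nonneg (meshStep_pos hT hγ hN (by omega)).le (meshStep_pos hT hγ hN (by omega)).le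

lemma stepRatio_le_max {n : ℕ} (hn : 2 ≤ n) (hnN : n ≤ N) :
    stepRatio T γ N n ≤ maxStepRatio T γ N := by
  rw [maxStepRatio, dif_pos (hn.trans hnN)]
  exact Finset.le_sup' _ (Finset.mem_Icc.2 ⟨hn, hnN⟩)

lemma maxStepRatio_nonneg (hT : 0 < T) (hγ : 1 ≤ γ) (hN : 1 ≤ N) : 0 ≤ maxStepRatio T γ N := by
  by_cases h : 2 ≤ N
  · exact (stepRatio_nonneg hT hγ hN le_rfl).trans (stepRatio_le_max le_rfl h)
  · rw [maxStepRatio, dif_neg h]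

/-! ### The kernels of the L1 formula -/

lemma exists_discreteKernel_eq (hT : 0 < T) (hγ : 1 ≤ γ) (hN : 1 ≤ N) (hα : α < 1)
    {n i : ℕ} (hi : 1 ≤ i) (hin : i ≤ n) :
    ∃ ξ ∈ Ioo (meshPt T γ N (i - 1)) (meshPt T γ N i),
      discreteKernel T γ N (1 - α) n i = fracKernel (1 - α) (meshPt T γ N n - ξ) :=
  exists_fracKernel_sub_eq_average (by linarith) (meshPt_strictMono hT hγ hN (by omega))
    ((meshPt_strictMono hT hγ hN).monotone hin)

lemma discreteKernel_pos (hT : 0 < T) (hγ : 1 ≤ γ) (hN : 1 ≤ N) (hα : α < 1)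
    {n i : ℕ} (hi : 1 ≤ i) (hin : i ≤ n) : 0 < discreteKernel T γ N (1 - α) n i := by
  obtain ⟨ξ, hξ, h⟩ := exists_discreteKernel_eq hT hγ hN hα hi hin
  rw [h]
  have := (meshPt_strictMono hT hγ hN).monotone hin
  exact fracKernel_pos (by linarith) (by linarith [hξ.2])

lemma discreteKernel_le_succ (hT : 0 < T) (hγ : 1 ≤ γ) (hN : 1 ≤ N) (hα0 : 0 < α) (hα : α < 1)
    {n i : ℕ} (hi : 1 ≤ i) (hin : i + 1 ≤ n) :
    discreteKernel T γ N (1 - α) n i ≤ discreteKernel T γ N (1 - α) n (i + 1) := by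
  obtain ⟨ξ, hξ, h⟩ := exists_discreteKernel_eq hT hγ hN hα hi (by omega : i ≤ n)
  obtain ⟨η, hη, h'⟩ := exists_discreteKernel_eq hT hγ hN hα (by omega : 1 ≤ i + 1) hin
  rw [h, h']
  have := (meshPt_strictMono hT hγ hN).monotone hin
  rw [Nat.add_sub_cancel] at hη
  exact fracKernel_antitoneOn (by linarith) (by linarith) (mem_Ioi.2 (by linarith [hη.2]))
    (mem_Ioi.2 (by linarith [hξ.2, hη.1, hη.2])) (by linarith [hξ.2, hη.1])

lemma discreteKernel_mul_meshStep (hT : 0 < T) (hγ : 1 ≤ γ) (hN : 1 ≤ N) (hα : α < 1)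
    {n i : ℕ} (hi : 1 ≤ i) :
    discreteKernel T γ N (1 - α) n i * meshStep T γ N i
      = fracKernel (2 - α) (meshPt T γ N n - meshPt T γ N (i - 1))
        - fracKernel (2 - α) (meshPt T γ N n - meshPt T γ N i) := by
  have h := (meshStep_pos hT hγ hN hi).ne'
  rw [discreteKernel, integral_fracKernel_sub (by linarith), show 1 - α + 1 = 2 - α by ring]
  field_simp

lemma discreteKernel_self (hT : 0 < T) (hγ : 1 ≤ γ) (hN : 1 ≤ N) (hα : α < 1)
    {n : ℕ} (hn : 1 ≤ n) :
    discreteKernel T γ N (1 - α) n n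
      = (Real.Gamma (2 - α) * meshStep T γ N n ^ α)⁻¹ := by
  have h := meshStep_pos hT hγ hN hn
  have h1 := discreteKernel_mul_meshStep hT hγ hN hα (n := n) hn
  rw [sub_self, show (2 : ℝ) - α = (1 - α) + 1 by ring, fracKernel_add_one_zero (by linarith),
    sub_zero, ← meshStep.eq_1, fracKernel, add_sub_cancel_right, Real.rpow_sub h, Real.rpow_one]
    at h1
  have h2 := Real.rpow_pos_of_pos h α
  have h3 := Real.Gamma_pos_of_pos (show 0 < 1 - α + 1 by linarith)
  rw [show (2 : ℝ) - α = (1 - α) + 1 by ring]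
  field_simp at h1 ⊢
  linarith

lemma sum_Icc_one_eq_sum_range {M : Type*} [AddCommMonoid M] (f : ℕ → M) (n : ℕ) :
    ∑ i ∈ Finset.Icc 1 n, f i = ∑ i ∈ Finset.range n, f (i + 1) := by
  induction n with
  | zero => simp
  | succ n ih => rw [Finset.sum_Icc_succ_top (by omega), ih, Finset.sum_range_succ]

lemma sum_Icc_one_sub_pred (f : ℕ → ℝ) (n : ℕ) :
    ∑ i ∈ Finset.Icc 1 n, (f i - f (i - 1)) = f n - f 0 := by
  rw [sum_Icc_one_eq_sum_range]
  simpa using Finset.sum_range_sub f n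

lemma sum_discreteKernel_mul_meshStep (hT : 0 < T) (hγ : 1 ≤ γ) (hN : 1 ≤ N) (hα : α < 1)
    (n : ℕ) :
    ∑ i ∈ Finset.Icc 1 n, discreteKernel T γ N (1 - α) n i * meshStep T γ N i
      = fracKernel (2 - α) (meshPt T γ N n) := by
  have h := sum_Icc_one_sub_pred
    (fun i => -fracKernel (2 - α) (meshPt T γ N n - meshPt T γ N i)) n
  rw [sub_self, meshPt_zero hγ, sub_zero, show (2 : ℝ) - α = (1 - α) + 1 by ring,
    fracKernel_add_one_zero (by linarith)] at h
  rw [show (2 : ℝ) - α = (1 - α) + 1 by ring]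
  rw [Finset.sum_congr rfl (g := fun i =>
    -fracKernel (1 - α + 1) (meshPt T γ N n - meshPt T γ N i)
      - -fracKernel (1 - α + 1) (meshPt T γ N n - meshPt T γ N (i - 1))), h]
  · ring
  · intro i hi
    rw [discreteKernel_mul_meshStep hT hγ hN hα (Finset.mem_Icc.1 hi).1,
      show (2 : ℝ) - α = (1 - α) + 1 by ring]
    ring

/-- Cellwise bounds for the Caputo derivative of `k_{p+1}`, which is `k_{p+1-α}`, add up. -/
lemma fracKernel_le_sum_of_cell_le (hT : 0 < T) (hγ : 1 ≤ γ) (hN : 1 ≤ N) (hα : α < 1)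
    {p : ℝ} (hp : 0 < p) {d : ℕ → ℝ} {n : ℕ} (hn : 1 ≤ n)
    (hd : ∀ i, 1 ≤ i → i ≤ n → ∫ s in (meshPt T γ N (i - 1))..(meshPt T γ N i),
      fracKernel (1 - α) (meshPt T γ N n - s) * fracKernel p s
        ≤ discreteKernel T γ N (1 - α) n i * d i) :
    fracKernel (p + (1 - α)) (meshPt T γ N n)
      ≤ ∑ i ∈ Finset.Icc 1 n, discreteKernel T γ N (1 - α) n i * d i := by
  have hmono := (meshPt_strictMono hT hγ hN).monotone
  have hpos := meshPt_pos hT hγ hN hn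
  have hint := intervalIntegrable_fracKernel_conv hp (show 0 < 1 - α by linarith) hpos
  have h := intervalIntegral.sum_integral_adjacent_intervals (a := meshPt T γ N) (n := n)
    (μ := volume) (f := fun s => fracKernel (1 - α) (meshPt T γ N n - s) * fracKernel p s)
    (fun k hk => hint.mono_set (by
      rw [uIcc_of_le (hmono (Nat.le_succ k)), uIcc_of_le hpos.le]
      exact Icc_subset_Icc (meshPt_nonneg hT k) (hmono hk)))
  rw [meshPt_zero hγ, integral_fracKernel_conv hp (by linarith) hpos] at h
  rw [← h, sum_Icc_one_eq_sum_range]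
  refine Finset.sum_le_sum fun i hi => ?_
  have := hd (i + 1) (by omega) (by have := Finset.mem_range.1 hi; omega)
  simpa using this

end Mesh

/-! ### Complementary kernels -/

/-- The weights of the discrete fractional integral at level `n`: `P` inverts, by summation, the
triangular array `K`. Monotonicity of the rows of `K` makes `P` nonnegative. -/
lemma exists_complementary_kernel {K : ℕ → ℕ → ℝ} {n : ℕ}
    (hpos : ∀ j, 1 ≤ j → j ≤ n → 0 < K j j)
    (hmono : ∀ j i, 1 ≤ i → i + 1 ≤ j → j ≤ n → K j i ≤ K j (i + 1)) :
    ∃ P : ℕ → ℝ, (∀ j, 0 ≤ P j) ∧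
      ∀ i, 1 ≤ i → i ≤ n → ∑ j ∈ Finset.Icc i n, P j * K j i = 1 := by
  suffices h : ∀ m, m ≤ n → ∃ P : ℕ → ℝ, (∀ j, 0 ≤ P j) ∧
      ∀ i, n < i + m → i ≤ n → ∑ j ∈ Finset.Icc i n, P j * K j i = 1 by
    obtain ⟨P, hP, h⟩ := h n le_rfl
    exact ⟨P, hP, fun i hi hin => h i (by omega) hin⟩
  intro m
  induction m with
  | zero => exact fun _ => ⟨0, fun _ => le_rfl, fun i h1 h2 => by omega⟩
  | succ m ih =>
    intro hm
    obtain ⟨P, hP, h⟩ := ih (by omega)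
    -- the equation at `l` forces the weight `P_l = (1 - ∑_{j > l} P_j K^{j,l}) / K^{l,l}`
    set l := n - m with hl
    have hKl : 0 < K l l := hpos l (by omega) (by omega)
    set σ := ∑ j ∈ Finset.Icc (l + 1) n, P j * K j l with hσ
    have hσ1 : σ ≤ 1 := by
      rcases Nat.eq_zero_or_pos m with rfl | hm0
      · rw [hσ, Finset.Icc_eq_empty (by omega), Finset.sum_empty]; norm_num
      · rw [← h (l + 1) (by omega) (by omega)]
        refine Finset.sum_le_sum fun j hj => ?_
        rw [Finset.mem_Icc] at hj
        exact mul_le_mul_of_nonneg_left (hmono j l (by omega) hj.1 hj.2) (hP j)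
    refine ⟨Function.update P l ((1 - σ) / K l l), fun j => ?_, fun i hi hin => ?_⟩
    · by_cases hj : j = l
      · subst hj
        simpa using div_nonneg (sub_nonneg.2 hσ1) hKl.le
      · simpa [hj] using hP j
    · have hne : ∀ a j, l < a → j ∈ Finset.Icc a n →
          Function.update P l ((1 - σ) / K l l) j = P j := fun a j ha hj => by
        rw [Finset.mem_Icc] at hj
        exact Function.update_of_ne (by omega) _ _
      by_cases hil : i = l
      · subst hil
        rw [← Finset.add_sum_Ioc_eq_sum_Icc (by omega : l ≤ n), ← Finset.Icc_add_one_left_eq_Ioc,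
          Function.update_self,
          Finset.sum_congr rfl fun j hj => by rw [hne (l + 1) j (by omega) hj], ← hσ]
        field_simp
        ring
      · rw [Finset.sum_congr rfl fun j hj => by rw [hne i j (by omega) hj]]
        exact h i (by omega) hin

lemma sum_mul_sum_triangle (P d : ℕ → ℝ) (K : ℕ → ℕ → ℝ) (n : ℕ) :
    ∑ j ∈ Finset.Icc 1 n, P j * ∑ i ∈ Finset.Icc 1 j, K j i * d i
      = ∑ i ∈ Finset.Icc 1 n, (∑ j ∈ Finset.Icc i n, P j * K j i) * d i := by
  simp only [Finset.mul_sum, Finset.sum_mul]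
  rw [Finset.sum_comm' (s' := fun i => Finset.Icc i n) (t' := Finset.Icc 1 n)]
  · refine Finset.sum_congr rfl fun i _ => Finset.sum_congr rfl fun j _ => by ring
  · intro j i
    simp only [Finset.mem_Icc]
    omega

lemma sum_complementary_le {P d w : ℕ → ℝ} {K : ℕ → ℕ → ℝ} {m n : ℕ} (hmn : m ≤ n)
    (hP : ∀ j, 0 ≤ P j) (hK : ∀ j i, 1 ≤ i → i ≤ j → 0 ≤ K j i)
    (hPK : ∀ i, 1 ≤ i → i ≤ n → ∑ j ∈ Finset.Icc i n, P j * K j i = 1)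
    (hd : ∀ i, 1 ≤ i → 0 ≤ d i)
    (hw : ∀ j, 1 ≤ j → j ≤ m → w j ≤ ∑ i ∈ Finset.Icc 1 j, K j i * d i) :
    ∑ j ∈ Finset.Icc 1 m, P j * w j ≤ ∑ i ∈ Finset.Icc 1 m, d i := by
  calc ∑ j ∈ Finset.Icc 1 m, P j * w j
      ≤ ∑ j ∈ Finset.Icc 1 m, P j * ∑ i ∈ Finset.Icc 1 j, K j i * d i :=
        Finset.sum_le_sum fun j hj => mul_le_mul_of_nonneg_left
          (hw j (Finset.mem_Icc.1 hj).1 (Finset.mem_Icc.1 hj).2) (hP j)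
    _ = ∑ i ∈ Finset.Icc 1 m, (∑ j ∈ Finset.Icc i m, P j * K j i) * d i :=
        sum_mul_sum_triangle P d K m
    _ ≤ ∑ i ∈ Finset.Icc 1 m, 1 * d i := by
        refine Finset.sum_le_sum fun i hi => ?_
        rw [Finset.mem_Icc] at hi
        refine mul_le_mul_of_nonneg_right ?_ (hd i hi.1)
        rw [← hPK i hi.1 (hi.2.trans hmn)]
        refine Finset.sum_le_sum_of_subset_of_nonneg (Finset.Icc_subset_Icc_right hmn)
          fun j hj _ => mul_nonneg (hP j) (hK j i hi.1 (Finset.mem_Icc.1 hj).1)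
    _ = _ := by simp

/-! ### The discrete fractional Grönwall inequality -/

section Gronwall

variable {T γ α : ℝ} {N : ℕ}

/-- For a concave power the discrete fractional integral is dominated by the continuous one. -/
lemma sum_complementary_fracKernel_le_of_le_one (hT : 0 < T) (hγ : 1 ≤ γ) (hN : 1 ≤ N)
    (hα0 : 0 < α) (hα : α < 1) {p : ℝ} (hp : 0 < p) (hp1 : p ≤ 1) {P : ℕ → ℝ} {m n : ℕ}
    (hmn : m ≤ n) (hP : ∀ j, 0 ≤ P j)
    (hPK : ∀ i, 1 ≤ i → i ≤ n →
      ∑ j ∈ Finset.Icc i n, P j * discreteKernel T γ N (1 - α) j i = 1) :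
    ∑ j ∈ Finset.Icc 1 m, P j * fracKernel (p + (1 - α)) (meshPt T γ N j)
      ≤ fracKernel (p + 1) (meshPt T γ N m) := by
  have hmono := (meshPt_strictMono hT hγ hN).monotone
  have h := sum_complementary_le hmn hP
    (fun j i h1 h2 => (discreteKernel_pos hT hγ hN hα h1 h2).le) hPK
    (d := fun i => fracKernel (p + 1) (meshPt T γ N i) - fracKernel (p + 1) (meshPt T γ N (i - 1)))
    (w := fun j => fracKernel (p + (1 - α)) (meshPt T γ N j))
    (fun i _ => sub_nonneg.2 (fracKernel_monotoneOn (by linarith)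
      (meshPt_nonneg hT _) (meshPt_nonneg hT _) (hmono (by omega))))
    (fun j hj _ => fracKernel_le_sum_of_cell_le hT hγ hN hα hp hj fun i h1 h2 =>
      integral_fracKernel_conv_cell_le_of_le_one hp hp1 (by linarith) (by linarith)
        (meshPt_nonneg hT _) (meshPt_strictMono hT hγ hN (by omega)) (hmono h2))
  rwa [sum_Icc_one_sub_pred (fun i => fracKernel (p + 1) (meshPt T γ N i)), meshPt_zero hγ,
    fracKernel_add_one_zero hp, sub_zero] at h

/-- For a general power the domination holds with the last level left out. In the convex case the
cell bound `Δt_i k_p(t_i)` is absorbed by the next cell, which is at least as long. -/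
lemma sum_complementary_fracKernel_le (hT : 0 < T) (hγ : 1 ≤ γ) (hN : 1 ≤ N)
    (hα0 : 0 < α) (hα : α < 1) {p : ℝ} (hp : 0 < p) {P : ℕ → ℝ} {m : ℕ}
    (hP : ∀ j, 0 ≤ P j)
    (hPK : ∀ i, 1 ≤ i → i ≤ m + 1 →
      ∑ j ∈ Finset.Icc i (m + 1), P j * discreteKernel T γ N (1 - α) j i = 1) :
    ∑ j ∈ Finset.Icc 1 m, P j * fracKernel (p + (1 - α)) (meshPt T γ N j)
      ≤ fracKernel (p + 1) (meshPt T γ N (m + 1)) := by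
  have hstr := meshPt_strictMono hT hγ hN
  have hmono := hstr.monotone
  rcases le_total p 1 with hp1 | hp1
  · exact (sum_complementary_fracKernel_le_of_le_one hT hγ hN hα0 hα hp hp1 (Nat.le_succ m)
      hP hPK).trans (fracKernel_monotoneOn (by linarith) (meshPt_nonneg hT _)
        (meshPt_nonneg hT _) (hmono (Nat.le_succ m)))
  have h := sum_complementary_le (Nat.le_succ m) hP
    (fun j i h1 h2 => (discreteKernel_pos hT hγ hN hα h1 h2).le) hPK
    (d := fun i => meshStep T γ N i * fracKernel p (meshPt T γ N i))
    (w := fun j => fracKernel (p + (1 - α)) (meshPt T γ N j))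
    (fun i hi => mul_nonneg (meshStep_pos hT hγ hN hi).le
      (fracKernel_nonneg hp (meshPt_nonneg hT _)))
    (fun j hj _ => fracKernel_le_sum_of_cell_le hT hγ hN hα hp hj fun i h1 h2 =>
      integral_fracKernel_conv_cell_le_of_one_le hp1 (by linarith)
        (meshPt_nonneg hT _) (hstr (by omega)) (hmono h2))
  refine h.trans ?_
  have hcell : ∀ i ∈ Finset.Icc 1 m, meshStep T γ N i * fracKernel p (meshPt T γ N i)
      ≤ fracKernel (p + 1) (meshPt T γ N (i + 1))
        - fracKernel (p + 1) (meshPt T γ N (i - 1 + 1)) := by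
    intro i hi
    have hi1 := (Finset.mem_Icc.1 hi).1
    rw [Nat.sub_add_cancel hi1, ← integral_fracKernel hp]
    calc meshStep T γ N i * fracKernel p (meshPt T γ N i)
        ≤ meshStep T γ N (i + 1) * fracKernel p (meshPt T γ N i) :=
          mul_le_mul_of_nonneg_right (meshStep_le_succ hT hγ hN hi1)
            (fracKernel_nonneg hp (meshPt_nonneg hT _))
      _ = ∫ _ in (meshPt T γ N i)..(meshPt T γ N (i + 1)), fracKernel p (meshPt T γ N i) := by
          rw [intervalIntegral.integral_const, smul_eq_mul, meshStep, Nat.add_sub_cancel]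
      _ ≤ _ := by
          refine intervalIntegral.integral_mono_on (hmono (Nat.le_succ i)) (by simp)
            (intervalIntegrable_fracKernel hp _ _) fun s hs => ?_
          exact fracKernel_monotoneOn hp1 (meshPt_nonneg hT _)
            ((meshPt_nonneg hT _).trans hs.1) hs.1
  refine (Finset.sum_le_sum hcell).trans ?_
  rw [sum_Icc_one_sub_pred (fun i => fracKernel (p + 1) (meshPt T γ N (i + 1)))]
  linarith [fracKernel_nonneg (show 0 < p + 1 by linarith) (meshPt_nonneg (N := N) (γ := γ) hT (0 + 1))]

/-- The discrete counterpart of the integral equation `μ I^α E_α(μ t^α) = E_α(μ t^α) - 1`. -/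
lemma sum_complementary_mittagLeffler_le (hT : 0 < T) (hγ : 1 ≤ γ) (hN : 1 ≤ N)
    (hα0 : 0 < α) (hα : α < 1) {μ : ℝ} (hμ : 0 ≤ μ) {P : ℕ → ℝ} {m : ℕ}
    (hP : ∀ j, 0 ≤ P j)
    (hPK : ∀ i, 1 ≤ i → i ≤ m + 1 →
      ∑ j ∈ Finset.Icc i (m + 1), P j * discreteKernel T γ N (1 - α) j i = 1) :
    ∑ j ∈ Finset.Icc 1 m, P j * (μ * mittagLeffler α (μ * meshPt T γ N j ^ α))
      ≤ mittagLeffler α (μ * meshPt T γ N (m + 1) ^ α) - 1 := by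
  have hz : ∀ j, 0 ≤ μ * meshPt T γ N j ^ α := fun j =>
    mul_nonneg hμ (Real.rpow_nonneg (meshPt_nonneg hT j) _)
  have hterm : ∀ j (k : ℕ), (μ * meshPt T γ N j ^ α) ^ k / Real.Gamma (1 + k * α)
      = μ ^ k * fracKernel (1 + k * α) (meshPt T γ N j) := by
    intro j k
    rw [fracKernel, add_sub_cancel_left, mul_comm (k : ℝ) α, Real.rpow_mul (meshPt_nonneg hT j),
      Real.rpow_natCast, mul_pow, mul_div_assoc]
  have hs : ∀ j, HasSum (fun k : ℕ => μ ^ k * fracKernel (1 + k * α) (meshPt T γ N j))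
      (mittagLeffler α (μ * meshPt T γ N j ^ α)) := fun j => by
    have := (summable_mittagLeffler hα0 (hz j)).hasSum
    simpa only [mittagLeffler, hterm] using this
  have hL := hasSum_sum (s := Finset.Icc 1 m)
    fun j _ => ((hs j).mul_left μ).mul_left (P j)
  have hR := (hasSum_nat_add_iff' 1).2 (hs (m + 1))
  rw [Finset.sum_range_one] at hR
  have e0 : μ ^ 0 * fracKernel (1 + ((0 : ℕ) : ℝ) * α) (meshPt T γ N (m + 1)) = 1 := by
    simp [fracKernel_one]
  rw [e0] at hR
  refine hasSum_le (fun k => ?_) hL hR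
  have h := sum_complementary_fracKernel_le hT hγ hN hα0 hα
    (show 0 < ((k + 1 : ℕ) : ℝ) * α by positivity) hP hPK
  have e1 : ((k + 1 : ℕ) : ℝ) * α + (1 - α) = 1 + k * α := by push_cast; ring
  rw [e1, add_comm _ (1 : ℝ)] at h
  calc ∑ j ∈ Finset.Icc 1 m, P j * (μ * (μ ^ k * fracKernel (1 + k * α) (meshPt T γ N j)))
      = μ ^ (k + 1) * ∑ j ∈ Finset.Icc 1 m, P j * fracKernel (1 + k * α) (meshPt T γ N j) := by
        rw [Finset.mul_sum]
        exact Finset.sum_congr rfl fun j _ => by ring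
    _ ≤ _ := mul_le_mul_of_nonneg_left h (pow_nonneg hμ _)

/-- Discrete fractional Grönwall inequality. The recursive hypothesis bounds the L1 derivative at
level `j` by `Λ max_{i ≤ j} W_i + G`; the maximum enters through its upper bounds `B`. -/
theorem le_mittagLeffler_of_l1Derivative_le (hT : 0 < T) (hγ : 1 ≤ γ) (hN : 1 ≤ N)
    (hα0 : 0 < α) (hα : α < 1) {Λ G : ℝ} (hΛ : 0 ≤ Λ) (hG : 0 ≤ G) {W : ℕ → ℝ}
    (hW0 : 0 ≤ W 0) {n : ℕ}
    (hstep : ∀ j, 1 ≤ j → j ≤ n → 2 * Λ ≤ discreteKernel T γ N (1 - α) j j)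
    (hrec : ∀ j, 1 ≤ j → j ≤ n → ∀ B, (∀ i ≤ j, W i ≤ B) →
      l1Derivative T γ N α W j ≤ Λ * B + G) :
    ∀ j ≤ n, W j ≤ 2 * mittagLeffler α (2 * Λ * meshPt T γ N j ^ α)
      * (W 0 + fracKernel (α + 1) (meshPt T γ N n) * G) := by
  have hmono := (meshPt_strictMono hT hγ hN).monotone
  set Ψ := W 0 + fracKernel (α + 1) (meshPt T γ N n) * G with hΨ
  have hk : 0 ≤ fracKernel (α + 1) (meshPt T γ N n) :=
    fracKernel_nonneg (by linarith) (meshPt_nonneg hT n)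
  have hΨ0 : W 0 ≤ Ψ := le_add_of_nonneg_right (mul_nonneg hk hG)
  have hΨpos : 0 ≤ Ψ := hW0.trans hΨ0
  set V : ℕ → ℝ := fun j => 2 * mittagLeffler α (2 * Λ * meshPt T γ N j ^ α) * Ψ with hV
  have hz : ∀ j, 0 ≤ 2 * Λ * meshPt T γ N j ^ α := fun j =>
    mul_nonneg (by positivity) (Real.rpow_nonneg (meshPt_nonneg hT j) _)
  have hVmono : Monotone V := fun i j hij => by
    refine mul_le_mul_of_nonneg_right (mul_le_mul_of_nonneg_left
      (mittagLeffler_mono hα0 (hz i) ?_) (by norm_num)) hΨpos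
    exact mul_le_mul_of_nonneg_left (Real.rpow_le_rpow (meshPt_nonneg hT i) (hmono hij) hα0.le)
      (by positivity)
  have hVΨ : ∀ j, 2 * Ψ ≤ V j := fun j => by
    have := one_le_mittagLeffler hα0 (hz j)
    simp only [hV]; nlinarith
  intro j
  change j ≤ n → W j ≤ V j
  induction j using Nat.strong_induction_on with
  | _ j ih =>
    intro hjn
    rcases Nat.eq_zero_or_pos j with rfl | hj
    · linarith [hVΨ 0]
    by_contra! hlt
    obtain ⟨m, rfl⟩ : ∃ m, j = m + 1 := ⟨j - 1, by omega⟩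
    obtain ⟨P, hP, hPK⟩ := exists_complementary_kernel
      (K := discreteKernel T γ N (1 - α)) (n := m + 1)
      (fun j h1 h2 => discreteKernel_pos hT hγ hN hα h1 le_rfl)
      (fun j i h1 h2 _ => discreteKernel_le_succ hT hγ hN hα0 hα h1 h2)
    -- summation against `P` inverts the L1 derivative
    have hinv : ∑ j ∈ Finset.Icc 1 (m + 1), P j * l1Derivative T γ N α W j
        = W (m + 1) - W 0 := by
      simp only [l1Derivative, smul_eq_mul]
      rw [sum_mul_sum_triangle P (fun i => W i - W (i - 1)), ← sum_Icc_one_sub_pred W]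
      refine Finset.sum_congr rfl fun i hi => ?_
      rw [hPK i (Finset.mem_Icc.1 hi).1 (Finset.mem_Icc.1 hi).2, one_mul]
    have hPG : ∑ j ∈ Finset.Icc 1 (m + 1), P j ≤ fracKernel (α + 1) (meshPt T γ N n) := by
      have h := sum_complementary_fracKernel_le_of_le_one hT hγ hN hα0 hα hα0 hα.le
        (le_refl (m + 1)) hP hPK
      simp only [add_sub_cancel, fracKernel_one, mul_one] at h
      exact h.trans (fracKernel_monotoneOn (by linarith) (meshPt_nonneg hT _)
        (meshPt_nonneg hT _) (hmono hjn))
    have hE := sum_complementary_mittagLeffler_le hT hγ hN hα0 hα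
      (show 0 ≤ 2 * Λ by linarith) hP hPK
    have hlast : P (m + 1) * Λ ≤ 1 / 2 := by
      have h1 := hPK (m + 1) (by omega) le_rfl
      rw [Finset.Icc_self, Finset.sum_singleton] at h1
      nlinarith [mul_le_mul_of_nonneg_left (hstep (m + 1) (by omega) hjn) (hP (m + 1))]
    have hsum : ∑ j ∈ Finset.Icc 1 m, P j * l1Derivative T γ N α W j
        ≤ ∑ j ∈ Finset.Icc 1 m, P j * (Λ * V j + G) := by
      refine Finset.sum_le_sum fun i hi => mul_le_mul_of_nonneg_left ?_ (hP i)
      rw [Finset.mem_Icc] at hi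
      exact hrec i hi.1 (by omega) _ fun l hl =>
        (ih l (by omega) (by omega)).trans (hVmono hl)
    have hcur : P (m + 1) * l1Derivative T γ N α W (m + 1)
        ≤ P (m + 1) * (Λ * W (m + 1) + G) := by
      refine mul_le_mul_of_nonneg_left (hrec (m + 1) (by omega) hjn _ fun l hl => ?_) (hP _)
      rcases Nat.lt_or_ge l (m + 1) with hl' | hl'
      · exact ((ih l hl' (by omega)).trans (hVmono hl)).trans hlt.le
      · rw [show l = m + 1 by omega]
    rw [Finset.sum_Icc_succ_top (by omega)] at hinv hPG
    have hsplit : ∑ j ∈ Finset.Icc 1 m, P j * (Λ * V j + G)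
        = Ψ * ∑ j ∈ Finset.Icc 1 m, P j * (2 * Λ * mittagLeffler α (2 * Λ * meshPt T γ N j ^ α))
          + G * ∑ j ∈ Finset.Icc 1 m, P j := by
      rw [Finset.mul_sum, Finset.mul_sum, ← Finset.sum_add_distrib]
      exact Finset.sum_congr rfl fun i _ => by simp only [hV]; ring
    have h1 := mul_le_mul_of_nonneg_left hE hΨpos
    have h2 := mul_le_mul_of_nonneg_left hPG hG
    have hWpos : 0 ≤ W (m + 1) := by linarith [hVΨ (m + 1)]
    have h3 := mul_le_mul_of_nonneg_right hlast hWpos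
    have h4 : V (m + 1) = 2 * (Ψ * mittagLeffler α (2 * Λ * meshPt T γ N (m + 1) ^ α)) := by
      simp only [hV]; ring
    nlinarith

end Gronwall

/-! ### Summation by parts and the discrete energy inequality -/

/-- The weights of the history terms in `∑ K_j (φ_j - φ_{j-1}) = K_n φ_n - ∑_{j < n} w_j φ_j`. -/
def historyWeight (K : ℕ → ℝ) (j : ℕ) : ℝ := K (j + 1) - if j = 0 then 0 else K j

lemma sum_smul_sub_pred_eq {V : Type*} [AddCommGroup V] [Module ℝ V] (K : ℕ → ℝ) (φ : ℕ → V)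
    {n : ℕ} (hn : 1 ≤ n) :
    ∑ j ∈ Finset.Icc 1 n, K j • (φ j - φ (j - 1))
      = K n • φ n - ∑ j ∈ Finset.range n, historyWeight K j • φ j := by
  induction n, hn using Nat.le_induction with
  | base => simp [historyWeight, smul_sub]
  | succ n hn ih =>
    rw [Finset.sum_Icc_succ_top (by omega), ih, Finset.sum_range_succ, historyWeight,
      if_neg (by omega), Nat.add_sub_cancel]
    module

lemma sum_historyWeight (K : ℕ → ℝ) {n : ℕ} (hn : 1 ≤ n) :
    ∑ j ∈ Finset.range n, historyWeight K j = K n := by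
  have h := sum_smul_sub_pred_eq K (fun _ => (1 : ℝ)) hn
  simp only [sub_self, smul_eq_mul, mul_zero, Finset.sum_const_zero, mul_one] at h
  linarith

section Energy

variable {T γ α : ℝ} {N : ℕ}

lemma historyWeight_discreteKernel_nonneg (hT : 0 < T) (hγ : 1 ≤ γ) (hN : 1 ≤ N) (hα0 : 0 < α)
    (hα : α < 1) {n j : ℕ} (hj : j < n) :
    0 ≤ historyWeight (discreteKernel T γ N (1 - α) n) j := by
  rw [historyWeight]
  split_ifs with h
  · rw [sub_zero]
    exact (discreteKernel_pos hT hγ hN hα (by omega) (by omega)).le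
  · exact sub_nonneg.2 (discreteKernel_le_succ hT hγ hN hα0 hα (by omega) (by omega))

lemma sum_historyWeight_mul_meshPt_sub (hT : 0 < T) (hγ : 1 ≤ γ) (hN : 1 ≤ N) (hα : α < 1)
    {n : ℕ} (hn : 1 ≤ n) :
    ∑ j ∈ Finset.range n, historyWeight (discreteKernel T γ N (1 - α) n) j
        * (meshPt T γ N n - meshPt T γ N j) = fracKernel (2 - α) (meshPt T γ N n) := by
  have h := sum_smul_sub_pred_eq (discreteKernel T γ N (1 - α) n)
    (fun j => meshPt T γ N j - meshPt T γ N n) hn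
  rw [sub_self, smul_zero, zero_sub] at h
  rw [← sum_discreteKernel_mul_meshStep hT hγ hN hα n]
  calc _ = -∑ j ∈ Finset.range n, historyWeight (discreteKernel T γ N (1 - α) n) j
        • (meshPt T γ N j - meshPt T γ N n) := by
        rw [← Finset.sum_neg_distrib]
        exact Finset.sum_congr rfl fun j _ => by rw [smul_eq_mul]; ring
    _ = _ := by
        rw [← h]
        exact Finset.sum_congr rfl fun j _ => by
          rw [smul_eq_mul, meshStep, sub_sub_sub_cancel_right]

/-- The discrete form of `a(φ, D^α φ) ≥ ½ D^α a(φ, φ)`, with the right-hand side expanded. -/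
lemma energy_le_two_mul_apply_l1Derivative {V : Type*} [AddCommGroup V] [Module ℝ V]
    (hT : 0 < T) (hγ : 1 ≤ γ) (hN : 1 ≤ N) (hα0 : 0 < α) (hα : α < 1)
    (a : V →ₗ[ℝ] V →ₗ[ℝ] ℝ) (hsymm : ∀ v w, a v w = a w v) (hpos : ∀ v, 0 ≤ a v v)
    (φ : ℕ → V) {n : ℕ} (hn : 1 ≤ n) :
    discreteKernel T γ N (1 - α) n n * a (φ n) (φ n)
        - ∑ j ∈ Finset.range n, historyWeight (discreteKernel T γ N (1 - α) n) j * a (φ j) (φ j)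
      ≤ 2 * a (φ n) (l1Derivative T γ N α φ n) := by
  set K := discreteKernel T γ N (1 - α) n with hK
  have hsum := sum_historyWeight K hn
  rw [l1Derivative, sum_smul_sub_pred_eq K φ hn, map_sub, map_smul, map_sum]
  simp only [map_smul, smul_eq_mul]
  have h : ∑ j ∈ Finset.range n, 2 * (historyWeight K j * a (φ n) (φ j))
      ≤ ∑ j ∈ Finset.range n, (historyWeight K j * a (φ n) (φ n)
        + historyWeight K j * a (φ j) (φ j)) := by
    refine Finset.sum_le_sum fun j hj => ?_
    have hw : 0 ≤ historyWeight K j :=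
      historyWeight_discreteKernel_nonneg hT hγ hN hα0 hα (Finset.mem_range.1 hj)
    have hq := hpos (φ n - φ j)
    simp only [map_sub, LinearMap.sub_apply] at hq
    rw [hsymm (φ j) (φ n)] at hq
    nlinarith [mul_nonneg hw hq]
  rw [← Finset.mul_sum, Finset.sum_add_distrib, ← Finset.sum_mul, hsum] at h
  linarith

end Energy

/-! ### The bilinear forms and the integral operator on `H₀¹(Ω)` -/

section Forms

variable {d : ℕ} {Ω : Set (EuclideanSpace ℝ (Fin d))}

/-- The inclusion `H₀¹(Ω) → L²(Ω)` as a linear map. -/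
def h01FunLinear (Ω : Set (EuclideanSpace ℝ (Fin d))) : H01 Ω →ₗ[ℝ] L2 Ω where
  toFun := h01Fun
  map_add' _ _ := rfl
  map_smul' _ _ := rfl

lemma norm_h01Fun_le (φ : H01 Ω) : ‖h01Fun φ‖ ≤ ‖φ‖ := by
  have h := WithLp.prod_norm_sq_eq_of_L2 φ.1
  have h2 : ‖φ‖ = ‖φ.1‖ := rfl
  rw [h2]
  refine le_of_sq_le_sq ?_ (norm_nonneg _)
  rw [h]
  exact le_add_of_nonneg_right (sq_nonneg _)

lemma memLp_h01Grad_apply (φ : H01 Ω) (i : Fin d) :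
    MemLp (fun x => h01Grad φ x i) 2 (volume.restrict Ω) :=
  (EuclideanSpace.proj (𝕜 := ℝ) i).comp_memLp' (Lp.memLp (h01Grad φ))

variable {A : ℝ → EuclideanSpace ℝ (Fin d) → Matrix (Fin d) (Fin d) ℝ} {t : ℝ}

lemma integrable_formA0 (hA : ∀ i j, MemLp (fun x => A t x i j) ⊤ (volume.restrict Ω))
    (φ ψ : H01 Ω) :
    Integrable (fun x => ∑ i, ∑ j, A t x i j * h01Grad φ x j * h01Grad ψ x i)
      (volume.restrict Ω) := by
  refine integrable_finsetSum _ fun i _ => integrable_finsetSum _ fun j _ => ?_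
  have h : MemLp (fun x => A t x i j * h01Grad φ x j) 2 (volume.restrict Ω) :=
    (memLp_h01Grad_apply φ j).mul (hA i j)
  exact h.integrable_mul (memLp_h01Grad_apply ψ i)

lemma formA0_add_left (hA : ∀ i j, MemLp (fun x => A t x i j) ⊤ (volume.restrict Ω))
    (φ₁ φ₂ ψ : H01 Ω) : formA0 A t (φ₁ + φ₂) ψ = formA0 A t φ₁ ψ + formA0 A t φ₂ ψ := by
  rw [formA0, formA0, formA0, ← integral_add (integrable_formA0 hA φ₁ ψ)
    (integrable_formA0 hA φ₂ ψ)]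
  refine integral_congr_ae ?_
  filter_upwards [Lp.coeFn_add (h01Grad φ₁) (h01Grad φ₂)] with x hx
  have hx' : h01Grad (φ₁ + φ₂) x = h01Grad φ₁ x + h01Grad φ₂ x := hx
  simp only [hx', PiLp.add_apply, mul_add, add_mul, Finset.sum_add_distrib]

lemma formA0_smul_left (r : ℝ) (φ ψ : H01 Ω) :
    formA0 A t (r • φ) ψ = r * formA0 A t φ ψ := by
  rw [formA0, formA0, ← integral_const_mul]
  refine integral_congr_ae ?_
  filter_upwards [Lp.coeFn_smul r (h01Grad φ)] with x hx
  have hx' : h01Grad (r • φ) x = r • h01Grad φ x := hx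
  simp only [hx', PiLp.smul_apply, smul_eq_mul, Finset.mul_sum]
  exact Finset.sum_congr rfl fun i _ => Finset.sum_congr rfl fun j _ => by ring

lemma formA0_comm (hsymm : ∀ᵐ x ∂(volume.restrict Ω), (A t x).IsSymm) (φ ψ : H01 Ω) :
    formA0 A t φ ψ = formA0 A t ψ φ := by
  refine integral_congr_ae ?_
  filter_upwards [hsymm] with x hx
  rw [Finset.sum_comm]
  refine Finset.sum_congr rfl fun i _ => Finset.sum_congr rfl fun j _ => ?_
  rw [hx.apply i j]
  ring

/-- `a₀(t; ·, ·)` as a bilinear map. -/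
noncomputable def formA0Bilin (hA : ∀ i j, MemLp (fun x => A t x i j) ⊤ (volume.restrict Ω))
    (hsymm : ∀ᵐ x ∂(volume.restrict Ω), (A t x).IsSymm) : H01 Ω →ₗ[ℝ] H01 Ω →ₗ[ℝ] ℝ :=
  LinearMap.mk₂ ℝ (formA0 A t) (formA0_add_left hA) formA0_smul_left
    (fun φ ψ₁ ψ₂ => by
      rw [formA0_comm hsymm, formA0_add_left hA, formA0_comm hsymm ψ₁, formA0_comm hsymm ψ₂])
    (fun r φ ψ => by rw [formA0_comm hsymm, formA0_smul_left, formA0_comm hsymm ψ, smul_eq_mul])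

lemma abs_integral_integralOp_mul_le
    {g : EuclideanSpace ℝ (Fin d) × EuclideanSpace ℝ (Fin d) → ℝ}
    (hg : AEStronglyMeasurable g ((volume.restrict Ω).prod (volume.restrict Ω))) {β : ℝ}
    (hβ : 0 ≤ β) {φ : L2 Ω}
    (hI : eLpNorm (integralOp g φ) 2 (volume.restrict Ω) ≤ ENNReal.ofReal (β * ‖φ‖)) (v : L2 Ω) :
    |∫ x in Ω, integralOp g φ x * v x| ≤ β * ‖φ‖ * ‖v‖ := by
  have hm : AEStronglyMeasurable (integralOp g φ) (volume.restrict Ω) :=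
    ((Lp.aestronglyMeasurable φ).comp_snd.mul hg).integral_prod_right'
  have hLp : MemLp (integralOp g φ) 2 (volume.restrict Ω) :=
    ⟨hm, hI.trans_lt ENNReal.ofReal_lt_top⟩
  have h1 : ∫ x in Ω, integralOp g φ x * v x = inner ℝ v (hLp.toLp _) := by
    rw [L2.inner_def]
    refine integral_congr_ae ?_
    filter_upwards [hLp.coeFn_toLp] with x hx
    rw [hx]
    simp
  have h2 : ‖hLp.toLp _‖ ≤ β * ‖φ‖ := by
    rw [Lp.norm_toLp]
    exact ENNReal.toReal_le_of_le_ofReal (by positivity) hI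
  rw [h1]
  calc _ ≤ ‖v‖ * ‖hLp.toLp _‖ := abs_real_inner_le_norm _ _
    _ ≤ ‖v‖ * (β * ‖φ‖) := mul_le_mul_of_nonneg_left h2 (norm_nonneg _)
    _ = _ := mul_comm _ _

lemma exists_mem_Ioc_near_of_ae {T t : ℝ} {p : ℝ → Prop}
    (hp : ∀ᵐ s ∂(volume.restrict (Ioc 0 T)), p s) (ht : t ∈ Ioc 0 T) {ε : ℝ} (hε : 0 < ε) :
    ∃ s ∈ Ioc 0 T, |t - s| ≤ ε ∧ p s := by
  have hlt : max 0 (t - ε) < t := max_lt ht.1 (by linarith)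
  have hsub : Ioc (max 0 (t - ε)) t ⊆ Ioc 0 T := fun s hs =>
    ⟨(le_max_left _ _).trans_lt hs.1, hs.2.trans ht.2⟩
  have h := ae_restrict_of_ae_restrict_of_subset hsub hp
  have hne : (ae (volume.restrict (Ioc (max 0 (t - ε)) t))).NeBot := by
    rw [ae_neBot, Ne, Measure.restrict_eq_zero, Real.volume_Ioc, ENNReal.ofReal_eq_zero]
    linarith
  obtain ⟨s, hs, hs'⟩ := (h.and (ae_restrict_mem measurableSet_Ioc)).exists
  refine ⟨s, hsub hs', ?_, hs⟩
  rw [abs_of_nonneg (by linarith [hs'.2])]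
  linarith [(le_max_right 0 (t - ε)).trans_lt hs'.1]

/-- A bound that holds for almost every time holds for every time, by Lipschitz continuity. -/
lemma le_of_ae_le_of_lipschitz {T t L r C : ℝ} {q : ℝ → ℝ} (hL : 0 ≤ L) (hr : 0 ≤ r)
    (hq : ∀ᵐ s ∂(volume.restrict (Ioc 0 T)), q s ≤ C)
    (hLip : ∀ t ∈ Ioc 0 T, ∀ s ∈ Ioc 0 T, |q t - q s| ≤ L * |t - s| * r) (ht : t ∈ Ioc 0 T) :
    q t ≤ C := by
  refine le_of_forall_pos_le_add fun δ hδ => ?_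
  have hM : 0 < L * r + 1 := by positivity
  obtain ⟨s, hs, hts, hqs⟩ := exists_mem_Ioc_near_of_ae hq ht (div_pos hδ hM)
  have h1 := (le_abs_self _).trans (hLip t ht s hs)
  have h2 : L * |t - s| * r ≤ δ := by
    calc L * |t - s| * r = (L * r) * |t - s| := by ring
      _ ≤ (L * r + 1) * (δ / (L * r + 1)) :=
        mul_le_mul (by linarith) hts (abs_nonneg _) hM.le
      _ = δ := mul_div_cancel₀ _ hM.ne'
  linarith

end Forms

/-! ### The extrapolation -/

/-- A constant `κ` with `‖Eφⁿ‖² ≤ κ max_{i ≤ n} ‖φⁱ‖²`. -/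
noncomputable def extrapolationConst (T γ : ℝ) (N : ℕ) : TimeScheme → ℝ
  | .fullyImplicit | .imexOne => 1
  | .imexTwo => 2 * ((1 + maxStepRatio T γ N) ^ 2 + maxStepRatio T γ N ^ 2)

lemma stabLambda_eq (β₀ β₁ β₂ L lam T γ : ℝ) (N : ℕ) (α : ℝ) (m : TimeScheme) :
    stabLambda β₀ β₁ β₂ L lam T γ N α m
      = 2 * ((β₁ ^ 2 + lam ^ 2 * β₂ ^ 2 * extrapolationConst T γ N m) / β₀)
        + L * T ^ (1 - α) / (β₀ * Real.Gamma (2 - α)) := by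
  cases m <;> simp only [stabLambda, extrapolationConst] <;> ring

lemma extrapolationConst_nonneg (T γ : ℝ) (N : ℕ) (m : TimeScheme) :
    0 ≤ extrapolationConst T γ N m := by
  cases m <;> simp only [extrapolationConst] <;> positivity

lemma norm_sq_extrapolate_le {V : Type*} [NormedAddCommGroup V] [NormedSpace ℝ V] {T γ : ℝ}
    {N : ℕ} (hT : 0 < T) (hγ : 1 ≤ γ) (hN : 1 ≤ N) (m : TimeScheme) {φ : ℕ → V} {n : ℕ}
    (hn : 1 ≤ n) (hnN : n ≤ N) {R : ℝ} (hR : ∀ i ≤ n, ‖φ i‖ ^ 2 ≤ R) :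
    ‖extrapolate T γ N m φ n‖ ^ 2 ≤ extrapolationConst T γ N m * R := by
  have hR0 : 0 ≤ R := (sq_nonneg _).trans (hR 0 (by omega))
  have hρ := maxStepRatio_nonneg hT hγ hN
  match m with
  | .fullyImplicit => simpa [extrapolate, extrapolationConst] using hR n le_rfl
  | .imexOne => simpa [extrapolate, extrapolationConst] using hR (n - 1) (by omega)
  | .imexTwo =>
    simp only [extrapolate, extrapolationConst]
    set ρ := maxStepRatio T γ N
    split_ifs with h
    · nlinarith [hR 0 (by omega), mul_nonneg hρ hR0, mul_nonneg (sq_nonneg ρ) hR0]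
    · have h0 := stepRatio_nonneg hT hγ hN (show 2 ≤ n by omega)
      have h1 : stepRatio T γ N n ≤ ρ := stepRatio_le_max (by omega) hnN
      set r := stepRatio T γ N n
      have h2 : ‖(1 + r) • φ (n - 1) - r • φ (n - 2)‖
          ≤ (1 + r) * ‖φ (n - 1)‖ + r * ‖φ (n - 2)‖ := by
        refine (norm_sub_le _ _).trans_eq ?_
        rw [norm_smul, norm_smul, Real.norm_of_nonneg h0, Real.norm_of_nonneg (by linarith)]
      calc _ ≤ ((1 + r) * ‖φ (n - 1)‖ + r * ‖φ (n - 2)‖) ^ 2 :=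
            pow_le_pow_left₀ (norm_nonneg _) h2 2
        _ ≤ 2 * ((1 + r) ^ 2 * ‖φ (n - 1)‖ ^ 2 + r ^ 2 * ‖φ (n - 2)‖ ^ 2) := by
            nlinarith [sq_nonneg ((1 + r) * ‖φ (n - 1)‖ - r * ‖φ (n - 2)‖)]
        _ ≤ 2 * ((1 + ρ) ^ 2 * R + ρ ^ 2 * R) := by
            gcongr
            · exact hR _ (by omega)
            · exact hR _ (by omega)
        _ = _ := by ring

/-! ### Stability in the `H¹`-norm -/

/-- The energies `W⁰ = γ₀ ‖u⁰‖₁²` and `Wʲ = a₀(t_j; uʲ, uʲ)`. The form is not controlled at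
`t_0 = 0`, so the initial energy is replaced by the bound that it satisfies at positive times. -/
noncomputable def discreteEnergy {d : ℕ} {Ω : Set (EuclideanSpace ℝ (Fin d))}
    (A : ℝ → EuclideanSpace ℝ (Fin d) → Matrix (Fin d) (Fin d) ℝ) (γ₀ T γ : ℝ) (N : ℕ)
    (u : ℕ → H01 Ω) (j : ℕ) : ℝ :=
  if j = 0 then γ₀ * ‖u 0‖ ^ 2 else formA0 A (meshPt T γ N j) (u j) (u j)

/-- The recursive inequality for the energies, obtained by testing the scheme with `D^α uⁿ`. -/
lemma l1Derivative_discreteEnergy_le {d : ℕ} {Ω : Set (EuclideanSpace ℝ (Fin d))}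
    {α T γ lam : ℝ} (hα0 : 0 < α) (hα1 : α < 1) (hT : 0 < T) (hγ : 1 ≤ γ)
    {A : ℝ → EuclideanSpace ℝ (Fin d) → Matrix (Fin d) (Fin d) ℝ}
    {b : ℝ → EuclideanSpace ℝ (Fin d) → EuclideanSpace ℝ (Fin d)}
    {c : ℝ → EuclideanSpace ℝ (Fin d) → ℝ}
    {g : EuclideanSpace ℝ (Fin d) × EuclideanSpace ℝ (Fin d) → ℝ}
    {f : ℝ → L2 Ω}
    (hA : ∀ t ∈ Ioc 0 T, ∀ i j, MemLp (fun x => A t x i j) ⊤ (volume.restrict Ω))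
    (hAsymm : ∀ t ∈ Ioc 0 T, ∀ᵐ x ∂(volume.restrict Ω), (A t x).IsSymm)
    (hg : AEStronglyMeasurable g ((volume.restrict Ω).prod (volume.restrict Ω)))
    {γ₀ β₀ L β₁ β₂ : ℝ} (hβ₀ : 0 < β₀) (hL : 0 ≤ L) (hβ₂ : 0 ≤ β₂)
    (hbdd : ∀ t ∈ Ioc 0 T, ∀ φ : H01 Ω, formA0 A t φ φ ≤ γ₀ * ‖φ‖ ^ 2)
    (hcoer : ∀ t ∈ Ioc 0 T, ∀ φ : H01 Ω, β₀ * ‖φ‖ ^ 2 ≤ formA0 A t φ φ)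
    (hLip : ∀ t ∈ Ioc 0 T, ∀ s ∈ Ioc 0 T, ∀ φ : H01 Ω,
      |formA0 A t φ φ - formA0 A s φ φ| ≤ L * |t - s| * ‖φ‖ ^ 2)
    (ha1 : ∀ t ∈ Ioc 0 T, ∀ φ ψ : H01 Ω, |formA1 b c t φ ψ| ≤ β₁ * ‖φ‖ * ‖h01Fun ψ‖)
    (hI : ∀ φ : L2 Ω,
      eLpNorm (integralOp g φ) 2 (volume.restrict Ω) ≤ ENNReal.ofReal (β₂ * ‖φ‖))
    {N : ℕ} {m : TimeScheme} {S : Submodule ℝ (H01 Ω)} {u0h : H01 Ω} {u : ℕ → H01 Ω}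
    (hu : IsDiscreteSolution A b c g f lam T γ N α m S u0h u)
    {n : ℕ} (hn : 1 ≤ n) (hnN : n ≤ N) {B : ℝ}
    (hB : ∀ i ≤ n, discreteEnergy A γ₀ T γ N u i ≤ B) :
    l1Derivative T γ N α (discreteEnergy A γ₀ T γ N u) n
      ≤ stabLambda β₀ β₁ β₂ L lam T γ N α m * B + ‖f (meshPt T γ N n)‖ ^ 2 := by
  have hN : 1 ≤ N := hn.trans hnN
  have hmem : ∀ j, 1 ≤ j → j ≤ N → meshPt T γ N j ∈ Ioc 0 T := fun j h1 h2 =>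
    ⟨meshPt_pos hT hγ hN h1, meshPt_le hT hγ hN h2⟩
  have ht := hmem n hn hnN
  set t := meshPt T γ N n with ht_def
  set W := discreteEnergy A γ₀ T γ N u with hW
  have hcoerW : ∀ j ≤ n, β₀ * ‖u j‖ ^ 2 ≤ W j := by
    intro j hj
    simp only [hW, discreteEnergy]
    split_ifs with h
    · subst h
      exact (hcoer t ht _).trans (hbdd t ht _)
    · exact hcoer _ (hmem j (by omega) (by omega)) _
  have hR : ∀ j ≤ n, ‖u j‖ ^ 2 ≤ B / β₀ := fun j hj => by
    rw [le_div_iff₀' hβ₀]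
    exact (hcoerW j hj).trans (hB j hj)
  have hB0 : 0 ≤ B := by
    refine le_trans ?_ ((hcoerW 0 (by omega)).trans (hB 0 (by omega)))
    positivity
  -- the test function
  set v : H01 Ω := l1Derivative T γ N α u n with hv
  have hvS : v ∈ S := by
    refine S.sum_mem fun j hj => S.smul_mem _ (S.sub_mem (hu.mem _ ?_) (hu.mem _ ?_)) <;>
    · rw [Finset.mem_Icc] at hj; omega
  have hvfun : l1Derivative T γ N α (fun k => h01Fun (u k)) n = h01Fun v := by
    change _ = h01FunLinear Ω v
    rw [hv, l1Derivative, l1Derivative, map_sum]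
    exact Finset.sum_congr rfl fun j _ => by rw [map_smul, map_sub]; rfl
  have heq := hu.eq n hn hnN v hvS
  rw [hvfun, real_inner_self_eq_norm_sq] at heq
  set X := ‖h01Fun v‖ with hX
  -- `a₀(t_n; uʲ, uʲ)` exceeds `Wʲ` by a Lipschitz term
  have hcompare : ∀ j ∈ Finset.range n,
      formA0 A t (u j) (u j) ≤ W j + L / β₀ * B * (t - meshPt T γ N j) := by
    intro j hj
    have hjn := Finset.mem_range.1 hj
    have hlt : 0 < t - meshPt T γ N j := sub_pos.2 (meshPt_strictMono hT hγ hN hjn)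
    rcases Nat.eq_zero_or_pos j with rfl | hj0
    · have h1 := hbdd t ht (u 0)
      have h2 : 0 ≤ L / β₀ * B * (t - meshPt T γ N 0) := by positivity
      simp only [hW, discreteEnergy, if_true]
      linarith
    · have h1 := (le_abs_self _).trans (hLip t ht _ (hmem j hj0 (by omega)) (u j))
      rw [abs_of_pos hlt] at h1
      have h2 : L * (t - meshPt T γ N j) * ‖u j‖ ^ 2 ≤ L * (t - meshPt T γ N j) * (B / β₀) :=
        mul_le_mul_of_nonneg_left (hR j hjn.le) (by positivity)
      have h3 : L * (t - meshPt T γ N j) * (B / β₀) = L / β₀ * B * (t - meshPt T γ N j) := by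
        ring
      simp only [hW, discreteEnergy, if_neg hj0.ne']
      linarith
  have henergy := energy_le_two_mul_apply_l1Derivative hT hγ hN hα0 hα1
    (formA0Bilin (hA t ht) (hAsymm t ht)) (formA0_comm (hAsymm t ht))
    (fun φ => (by positivity : 0 ≤ β₀ * ‖φ‖ ^ 2).trans (hcoer t ht φ)) u hn
  simp only [formA0Bilin, LinearMap.mk₂_apply] at henergy
  rw [← hv] at henergy
  have hDW : l1Derivative T γ N α W n
      = discreteKernel T γ N (1 - α) n n * formA0 A t (u n) (u n)
        - ∑ j ∈ Finset.range n, historyWeight (discreteKernel T γ N (1 - α) n) j * W j := by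
    have e : W n = formA0 A t (u n) (u n) := by
      simp only [hW, discreteEnergy, if_neg (show n ≠ 0 by omega), ht_def]
    rw [← e, l1Derivative, sum_smul_sub_pred_eq _ W hn]
    simp only [smul_eq_mul]
  have hhist : ∑ j ∈ Finset.range n,
        historyWeight (discreteKernel T γ N (1 - α) n) j * formA0 A t (u j) (u j)
      ≤ ∑ j ∈ Finset.range n, historyWeight (discreteKernel T γ N (1 - α) n) j * W j
        + L / β₀ * B * fracKernel (2 - α) t := by
    rw [← sum_historyWeight_mul_meshPt_sub hT hγ hN hα1 hn, Finset.mul_sum,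
      ← Finset.sum_add_distrib]
    refine Finset.sum_le_sum fun j hj => ?_
    have := mul_le_mul_of_nonneg_left (hcompare j hj)
      (historyWeight_discreteKernel_nonneg hT hγ hN hα0 hα1 (Finset.mem_range.1 hj))
    linarith
  have hker : L / β₀ * B * fracKernel (2 - α) t
      ≤ L * T ^ (1 - α) / (β₀ * Real.Gamma (2 - α)) * B := by
    have h1 : fracKernel (2 - α) t ≤ fracKernel (2 - α) T :=
      fracKernel_monotoneOn (by linarith) ht.1.le hT.le ht.2
    refine (mul_le_mul_of_nonneg_left h1 (by positivity)).trans_eq ?_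
    rw [fracKernel, show 2 - α - 1 = 1 - α by ring]
    have := (Real.Gamma_pos_of_pos (show 0 < 2 - α by linarith)).ne'
    field_simp
  -- the lower-order terms
  set E := extrapolate T γ N m (fun k => h01Fun (u k)) n with hE
  have hE2 : ‖E‖ ^ 2 ≤ extrapolationConst T γ N m * (B / β₀) :=
    norm_sq_extrapolate_le hT hγ hN m hn hnN fun i hi =>
      (pow_le_pow_left₀ (norm_nonneg _) (norm_h01Fun_le (u i)) 2).trans (hR i hi)
  have h1 := neg_le_of_abs_le (ha1 t ht (u n) v)
  have h2 : lam * ∫ x in Ω, integralOp g E x * h01Fun v x ≤ |lam| * (β₂ * ‖E‖ * X) :=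
    (le_abs_self _).trans (by
      rw [abs_mul]
      exact mul_le_mul_of_nonneg_left (abs_integral_integralOp_mul_le hg hβ₂ (hI E) _)
        (abs_nonneg _))
  have h3 : inner ℝ (f t) (h01Fun v) ≤ ‖f t‖ * X := real_inner_le_norm _ _
  set p := β₁ * ‖u n‖ with hp
  set q := |lam| * β₂ * ‖E‖ with hq
  set r := ‖f t‖ with hr
  have ha0 : 2 * formA0 A t (u n) v ≤ 2 * p ^ 2 + 2 * q ^ 2 + r ^ 2 := by
    have h4 : formA0 A t (u n) v ≤ -X ^ 2 + (p + q + r) * X := by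
      have : |lam| * (β₂ * ‖E‖ * X) = q * X := by rw [hq]; ring
      linarith
    nlinarith [sq_nonneg (2 * X - (p + q + r)), sq_nonneg (p - q), sq_nonneg (p + q - r)]
  have hp2 : p ^ 2 ≤ β₁ ^ 2 * (B / β₀) := by
    rw [hp, mul_pow]
    exact mul_le_mul_of_nonneg_left (hR n le_rfl) (sq_nonneg _)
  have hq2 : q ^ 2 ≤ lam ^ 2 * β₂ ^ 2 * (extrapolationConst T γ N m * (B / β₀)) := by
    rw [hq, mul_pow, mul_pow, sq_abs]
    exact mul_le_mul_of_nonneg_left hE2 (by positivity)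
  have hΛ : 2 * (β₁ ^ 2 * (B / β₀))
      + 2 * (lam ^ 2 * β₂ ^ 2 * (extrapolationConst T γ N m * (B / β₀)))
      + L * T ^ (1 - α) / (β₀ * Real.Gamma (2 - α)) * B
      = stabLambda β₀ β₁ β₂ L lam T γ N α m * B := by
    rw [stabLambda_eq]; ring
  linarith

theorem mainTheorem7 {d : ℕ} (hd : 1 ≤ d) (Ω : Set (EuclideanSpace ℝ (Fin d)))
    (hΩ : IsOpen Ω) (hΩb : Bornology.IsBounded Ω)
    (α T γ lam : ℝ) (hα0 : 0 < α) (hα1 : α < 1) (hT : 0 < T) (hγ : 1 ≤ γ)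
    -- the coefficients, the kernel and the source
    (A : ℝ → EuclideanSpace ℝ (Fin d) → Matrix (Fin d) (Fin d) ℝ)
    (b : ℝ → EuclideanSpace ℝ (Fin d) → EuclideanSpace ℝ (Fin d))
    (c : ℝ → EuclideanSpace ℝ (Fin d) → ℝ)
    (g : EuclideanSpace ℝ (Fin d) × EuclideanSpace ℝ (Fin d) → ℝ)
    (f : ℝ → L2 Ω)
    (hA : ∀ t ∈ Ioc 0 T, ∀ i j, MemLp (fun x => A t x i j) ⊤ (volume.restrict Ω))
    (hAsymm : ∀ t ∈ Ioc 0 T, ∀ᵐ x ∂(volume.restrict Ω), (A t x).IsSymm)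
    (hb : ∀ t ∈ Ioc 0 T, MemLp (b t) ⊤ (volume.restrict Ω))
    (hc : ∀ t ∈ Ioc 0 T, MemLp (c t) ⊤ (volume.restrict Ω))
    (hg : MemLp g ⊤ ((volume.restrict Ω).prod (volume.restrict Ω)))
    -- the constants of boundedness, coercivity and Lipschitz continuity
    (γ₀ β₀ L β₁ β₂ : ℝ) (hγ₀ : 0 < γ₀) (hβ₀ : 0 < β₀) (hL : 0 ≤ L)
    (hβ₁ : 0 ≤ β₁) (hβ₂ : 0 ≤ β₂)
    (hbdd : ∀ᵐ t ∂(volume.restrict (Ioc 0 T)), ∀ φ ψ : H01 Ω,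
      |formA0 A t φ ψ| ≤ γ₀ * ‖φ‖ * ‖ψ‖)
    (hcoer : ∀ᵐ t ∂(volume.restrict (Ioc 0 T)), ∀ φ : H01 Ω,
      β₀ * ‖φ‖ ^ 2 ≤ formA0 A t φ φ)
    (hLip : ∀ t ∈ Ioc 0 T, ∀ s ∈ Ioc 0 T, ∀ φ : H01 Ω,
      |formA0 A t φ φ - formA0 A s φ φ| ≤ L * |t - s| * ‖φ‖ ^ 2)
    (ha1 : ∀ t ∈ Ioc 0 T, ∀ φ ψ : H01 Ω, |formA1 b c t φ ψ| ≤ β₁ * ‖φ‖ * ‖h01Fun ψ‖)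
    (hI : ∀ φ : L2 Ω,
      eLpNorm (integralOp g φ) 2 (volume.restrict Ω) ≤ ENNReal.ofReal (β₂ * ‖φ‖))
    -- the discretization
    (N : ℕ) (m : TimeScheme) (S : Submodule ℝ (H01 Ω)) [FiniteDimensional ℝ S]
    (hstep : ∀ j, 1 ≤ j → j ≤ N →
      2 * stabLambda β₀ β₁ β₂ L lam T γ N α m * Real.Gamma (2 - α) * meshStep T γ N j ^ α < 1)
    (u0h : H01 Ω) (u : ℕ → H01 Ω)
    (hu : IsDiscreteSolution A b c g f lam T γ N α m S u0h u)
    (n : ℕ) (hn : 1 ≤ n) (hnN : n ≤ N) :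
    ‖u n‖ ≤ 2 * stabC γ₀ β₀ T α
        * mittagLeffler α (2 * stabLambda β₀ β₁ β₂ L lam T γ N α m * meshPt T γ N n ^ α)
        * (‖u 0‖ + (Finset.Icc 1 n).sup' (Finset.nonempty_Icc.2 hn)
            (fun j => ‖f (meshPt T γ N j)‖)) := by
  have hN : 1 ≤ N := hn.trans hnN
  have hbdd' : ∀ t ∈ Ioc 0 T, ∀ φ : H01 Ω, formA0 A t φ φ ≤ γ₀ * ‖φ‖ ^ 2 := fun t ht φ =>
    le_of_ae_le_of_lipschitz (q := fun s => formA0 A s φ φ) hL (sq_nonneg ‖φ‖)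
      (hbdd.mono fun s hs => ((le_abs_self _).trans (hs φ φ)).trans_eq (by ring))
      (fun t ht s hs => hLip t ht s hs φ) ht
  have hcoer' : ∀ t ∈ Ioc 0 T, ∀ φ : H01 Ω, β₀ * ‖φ‖ ^ 2 ≤ formA0 A t φ φ := fun t ht φ =>
    neg_le_neg_iff.1 (le_of_ae_le_of_lipschitz (q := fun s => -formA0 A s φ φ) hL
      (sq_nonneg ‖φ‖) (hcoer.mono fun s hs => neg_le_neg (hs φ))
      (fun t ht s hs => by
        rw [neg_sub_neg, abs_sub_comm]
        exact hLip t ht s hs φ) ht)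
  set Λ := stabLambda β₀ β₁ β₂ L lam T γ N α m with hΛ
  set F := (Finset.Icc 1 n).sup' (Finset.nonempty_Icc.2 hn) (fun j => ‖f (meshPt T γ N j)‖)
    with hF
  have hfF : ∀ j, 1 ≤ j → j ≤ n → ‖f (meshPt T γ N j)‖ ≤ F := fun j h1 h2 =>
    Finset.le_sup' (fun j => ‖f (meshPt T γ N j)‖) (Finset.mem_Icc.2 ⟨h1, h2⟩)
  have hF0 : 0 ≤ F := (norm_nonneg _).trans (hfF n hn le_rfl)
  have hΓ := Real.Gamma_pos_of_pos (show 0 < 2 - α by linarith)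
  have hΛ0 : 0 ≤ Λ := by
    have := extrapolationConst_nonneg T γ N m
    rw [hΛ, stabLambda_eq]
    positivity
  have htn := meshPt_pos hT hγ hN hn
  have htT := meshPt_le hT hγ hN hnN
  have hW := le_mittagLeffler_of_l1Derivative_le hT hγ hN hα0 hα1 hΛ0 (sq_nonneg F)
    (W := discreteEnergy A γ₀ T γ N u) (n := n)
    (by simp only [discreteEnergy, if_true]; positivity)
    (fun j h1 h2 => by
      have hs := Real.rpow_pos_of_pos (meshStep_pos hT hγ hN h1) α
      rw [discreteKernel_self hT hγ hN hα1 h1, ← one_div, le_div_iff₀ (mul_pos hΓ hs), ← mul_assoc]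
      exact (hstep j h1 (h2.trans hnN)).le)
    (fun j h1 h2 B hB => (l1Derivative_discreteEnergy_le hα0 hα1 hT hγ hA hAsymm hg.1 hβ₀ hL
      hβ₂ hbdd' hcoer' hLip ha1 hI hu h1 (h2.trans hnN) hB).trans
        (add_le_add le_rfl (pow_le_pow_left₀ (norm_nonneg _) (hfF j h1 h2) 2)))
    n le_rfl
  simp only [discreteEnergy, if_neg (show n ≠ 0 by omega), if_true] at hW
  set M := mittagLeffler α (2 * Λ * meshPt T γ N n ^ α) with hM
  have hM1 : 1 ≤ M := one_le_mittagLeffler hα0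
    (mul_nonneg (by positivity) (Real.rpow_nonneg htn.le _))
  set C := stabC γ₀ β₀ T α with hC
  have hC0 : 0 ≤ C := (Real.sqrt_nonneg _).trans (le_max_left _ _)
  have hCγ : γ₀ ≤ β₀ * C ^ 2 := by
    rw [← div_le_iff₀' hβ₀]
    exact (Real.sqrt_le_left hC0).1 (le_max_left _ _)
  have hCT : 2 * T ^ α ≤ β₀ * C ^ 2 := by
    rw [← div_le_iff₀' hβ₀]
    exact (Real.sqrt_le_left hC0).1 (le_max_right _ _)
  -- `1 / Γ(1 + α) ≤ e < 4`
  have hk : fracKernel (α + 1) (meshPt T γ N n) ≤ 4 * T ^ α := by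
    have h1 := rpow_mul_exp_neg_le_Gamma zero_le_one hα0.le
    rw [Real.one_rpow, one_mul, add_comm 1 α] at h1
    have h2 : (1 / 4 : ℝ) ≤ Real.exp (-1) := by
      rw [Real.exp_neg, ← one_div]
      exact one_div_le_one_div_of_le (Real.exp_pos 1) (by linarith [Real.exp_one_lt_d9])
    have h3 := Real.rpow_le_rpow htn.le htT hα0.le
    have h4 : 0 ≤ T ^ α := Real.rpow_nonneg hT.le _
    rw [fracKernel, add_sub_cancel_right, div_le_iff₀ (by linarith)]
    nlinarith
  have hfinal : β₀ * ‖u n‖ ^ 2 ≤ β₀ * (2 * C * M * (‖u 0‖ + F)) ^ 2 := by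
    calc β₀ * ‖u n‖ ^ 2 ≤ 2 * M * (γ₀ * ‖u 0‖ ^ 2 + fracKernel (α + 1) (meshPt T γ N n) * F ^ 2) :=
          (hcoer' _ ⟨htn, htT⟩ _).trans hW
      _ ≤ 2 * M * (β₀ * C ^ 2 * ‖u 0‖ ^ 2 + 2 * (β₀ * C ^ 2) * F ^ 2) := by
          gcongr
          linarith
      _ ≤ 2 * M * (2 * (β₀ * C ^ 2) * (‖u 0‖ + F) ^ 2) := by
          refine mul_le_mul_of_nonneg_left ?_ (by positivity)
          have h1 : 0 ≤ β₀ * C ^ 2 := by positivity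
          nlinarith [mul_nonneg h1 (mul_nonneg (norm_nonneg (u 0)) hF0),
            mul_nonneg h1 (sq_nonneg ‖u 0‖)]
      _ = M * (4 * β₀ * C ^ 2 * (‖u 0‖ + F) ^ 2) := by ring
      _ ≤ M ^ 2 * (4 * β₀ * C ^ 2 * (‖u 0‖ + F) ^ 2) :=
          mul_le_mul_of_nonneg_right (by nlinarith) (by positivity)
      _ = _ := by ring
  exact le_of_sq_le_sq (le_of_mul_le_mul_left hfinal hβ₀) (by positivity)
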